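/- \textbf{Setting.} Let $h_1,\dots,h_K\in\mathbb C^M$, $\sigma_k>0$, $\bar\gamma_k>0$ $(1\le k\le K)$ and $\bar C_m>0$ $(1\le m\le M)$. For an $M\times M$ matrix $A$ write $A^{(i,j)}$ for its entries and $[A]_m$ for the $M\times M$ matrix obtained from $A$ by replacing all entries outside the block $A^{(m:M,m:M)}$ by $0$; let $E_m=e_me_m^\dagger$ and $\eta_m=2^{\bar C_m}$. Problem (P) is to minimize $\sum_k\|v_k\|^2+\mathrm{tr}(Q)$ over $v_1,\dots,v_K\in\mathbb C^M$ and $Q\succeq 0$ subject to $$\tfrac1{\bar\gamma_k}|h_k^\dagger v_k|^2-\Big(\sum_{j\ne k}|h_k^\dagger v_j|^2+h_k^\dagger Qh_k+\sigma_k^2\Big)\ge 0\ \ \forall k,\qquad \eta_m[Q]_m-\Big(\sum_k|v_{k,m}|^2+Q^{(m,m)}\Big)E_m\succeq 0\ \ \forall m .$$ Its semidefinite relaxation (SDR) is to minimize $\sum_k\mathrm{tr}(V_k)+\mathrm{tr}(Q)$ over $V_k\succeq0$, $Q\succeq0$ subject to $a_k(V,Q):=\tfrac1{\bar\gamma_k}h_k^\dagger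 V_kh_k-\sum_{j\ne k}h_k^\dagger V_jh_k-h_k^\dagger Qh_k-\sigma_k^2\ge0$ for all $k$ and $B_m(V,Q):=\eta_m[Q]_m-\big(\sum_kV_k^{(m,m)}+Q^{(m,m)}\big)E_m\succeq0$ for all $m$. It is called strictly feasible if there are $V_k\succ0$ and $Q\succ0$ with $a_k(V,Q)>0$ for all $k$ and $B_m(V,Q)^{(m:M,m:M)}\succ0$ for all $m$. For $\beta\in\mathbb R^K$ and $M\times M$ matrices $\Lambda_1,\dots,\Lambda_M$ put $\Gamma(\beta)=I+\sum_k\beta_kh_kh_k^\dagger$, $C_k(\beta,\Lambda)=I+\sum_{j\ne k}\beta_jh_jh_j^\dagger+\sum_m\Lambda_m^{(m,m)}E_m$, $D(\beta,\Lambda)=\Gamma(\beta)+\sum_m\Lambda_m^{(m,m)}E_m-\sum_m\eta_m[\Lambda_m]_m$ and $S_k(\beta,\Lambda)=C_k(\beta,\Lambda)-\frac{\beta_k}{\bar\gamma_k}h_kh_k^\dagger$. The enhanced KKT conditions for $(V,Q,\beta,\Lambda)$ are: $\mathrm{tr}(V_kS_k)=0$ and $\mathrm{tr}(\Lambda_mB_m)=0$;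 $D=0$; $\Lambda_m\succeq0$, $\mathrm{rank}(\Lambda_m)\le1$, and all entries of $\Lambda_m$ outside the block $(m:M,m:M)$ vanish; $\beta\ge0$; $S_k\succeq0$ and $\mathrm{rank}(S_k)=M-1$; $V_k\succeq0$ and $\mathrm{rank}(V_k)=1$; $a_k=0$; $B_m\succeq0$; $Q\succeq0$ (for all $k$ and $m$). \textbf{FPI algorithm.} \emph{Dual step.} Given $\beta\ge 0$, compute $\Lambda_1(\beta),\dots,\Lambda_M(\beta)$ successively: start with $\Gamma_1=\Gamma(\beta)$; let $\Lambda_m(\beta)$ be zero outside the block $(m:M,m:M)$, where it is $$\begin{bmatrix}\frac{1}{\eta_m-1}\Gamma_m^{(m,m)}&\frac1{\eta_m}\Gamma_m^{(m,m+1:M)}\\ \frac1{\eta_m}\Gamma_m^{(m+1:M,m)}&\frac{\eta_m-1}{\eta_m^2}\frac{\Gamma_m^{(m+1:M,m)}\Gamma_m^{(m,m+1:M)}}{\Gamma_m^{(m,m)}}\end{bmatrix},$$ and let $\Gamma_{m+1}=\Gamma_m-\eta_m[\Lambda_m(\beta)]_m+\Lambda_m(\beta)^{(m,m)}E_m$.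 Put $I_k(\beta)=\bar\gamma_k\big/\big(h_k^\dagger C_k(\beta,\Lambda(\beta))^{-1}h_k\big)$ and iterate $\beta^{(i+1)}=I(\beta^{(i)})$ from some $\beta^{(0)}\ge0$; let $\beta$ be the limit. \emph{Primal step.} For this $\beta$ let $\hat v_k=C_k^{-1}h_k/\|C_k^{-1}h_k\|$ with $C_k=C_k(\beta,\Lambda(\beta))$, $\hat V_k=\hat v_k\hat v_k^\dagger$, and $\Lambda_m(\beta)=\lambda_m\lambda_m^\dagger$. For $p\in\mathbb R^K$ let $Q(p)$ be the Hermitian matrix computed for $m=M,M-1,\dots,1$ by $$Q^{(m+1:M,m)}=-\frac{Q^{(m+1:M,m+1:M)}\lambda_m^{(m+1:M)}}{\lambda_m^{(m)}},$$ $$Q^{(m,m)}=\frac{\eta_m}{\eta_m-1}\frac{(\lambda_m^{(m+1:M)})^\dagger Q^{(m+1:M,m+1:M)}\lambda_m^{(m+1:M)}}{|\lambda_m^{(m)}|^2}+\frac{1}{\eta_m-1}\sum_kp_k\hat V_k^{(m,m)},$$ put $J_k(p)=\bar\gamma_k\big(\sum_{j\ne k}p_jh_k^\dagger\hat V_jh_k+h_k^\dagger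 Q(p)h_k+\sigma_k^2\big)\big/\big(h_k^\dagger\hat V_kh_k\big)$, and iterate $p^{(i+1)}=J(p^{(i)})$ from some $p^{(0)}\ge0$; let $p$ be the limit. \emph{Output.} Vectors $v_k$ with $p_k\hat V_k=v_kv_k^\dagger$ for all $k$, and $Q=Q(p)$. \textbf{Theorem.} Assume that the SDR is strictly feasible. Then, for all starting points $\beta^{(0)}\ge0$ and $p^{(0)}\ge0$, the dual iteration converges to a fixed point $\beta$ of $I$, the primal iteration defined with this $\beta$ converges to a fixed point $p$ of $J$, and $(\{p_k\hat V_k\},Q(p),\beta,\{\Lambda_m(\beta)\})$ satisfies the enhanced KKT conditions of the SDR. Vectors $v_k$ with $p_k\hat V_k=v_kv_k^\dagger$ exist, and for every such choice $(\{v_k\},Q(p))$ is a globally optimal solution of (P). -/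

import Mathlib

open Filter Topology Matrix
open scoped ComplexOrder

/-- Data of a cooperative cellular network with `M` relays and `K` users: channel vectors `h k`,
noise standard deviations `σ k`, SINR targets `γ k` and fronthaul capacities `C m`.
Relay indices `1, …, M` of the mathematics are `0, …, M - 1` here. -/
structure RelayNetwork (M K : ℕ) where
  h : Fin K → Fin M → ℂ
  σ : Fin K → ℝ
  γ : Fin K → ℝ
  C : Fin M → ℝ

namespace RelayNetwork

variable {M K : ℕ} (N : RelayNetwork M K)

/-- The factor `2 ^ C m`. -/
noncomputable def η (m : Fin M) : ℝ := (2 : ℝ) ^ N.C m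

/-- The (real) value of the Hermitian form `x† A x`. -/
noncomputable def qform (x : Fin M → ℂ) (A : Matrix (Fin M) (Fin M) ℂ) : ℝ :=
  (star x ⬝ᵥ (A *ᵥ x)).re

/-- The rank-one matrix `x x†`. -/
def outer (x : Fin M → ℂ) : Matrix (Fin M) (Fin M) ℂ := vecMulVec x (star x)

/-- `E m = e_m e_m†`. -/
def E (m : Fin M) : Matrix (Fin M) (Fin M) ℂ := Matrix.single m m 1

/-- The block matrix `[0, 0; 0, A^(m:M, m:M)]`, of the same size as `A`. -/
def tailBlock (m : Fin M) (A : Matrix (Fin M) (Fin M) ℂ) : Matrix (Fin M) (Fin M) ℂ :=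
  Matrix.of fun i j => if m ≤ i ∧ m ≤ j then A i j else 0

/-! ### The nonconvex problem (P) in the variables `v 1, …, v K` and `Q` -/

/-- Total transmit power. -/
noncomputable def power (v : Fin K → Fin M → ℂ) (Q : Matrix (Fin M) (Fin M) ℂ) : ℝ :=
  (∑ k, ∑ m, ‖v k m‖ ^ 2) + Q.trace.re

/-- Feasibility for problem (P). -/
structure IsFeasible (v : Fin K → Fin M → ℂ) (Q : Matrix (Fin M) (Fin M) ℂ) : Prop where
  cov : Q.PosSemidef
  sinr : ∀ k, 0 ≤ 1 / N.γ k * ‖star (N.h k) ⬝ᵥ v k‖ ^ 2 -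
    (∑ j ∈ Finset.univ.erase k, ‖star (N.h k) ⬝ᵥ v j‖ ^ 2 + qform (N.h k) Q + N.σ k ^ 2)
  fronthaul : ∀ m, ((N.η m : ℂ) • tailBlock m Q -
    (((∑ k, ‖v k m‖ ^ 2 : ℝ) : ℂ) + Q m m) • E m).PosSemidef

/-- Global optimality for problem (P). -/
def IsGlobalOptimum (v : Fin K → Fin M → ℂ) (Q : Matrix (Fin M) (Fin M) ℂ) : Prop :=
  N.IsFeasible v Q ∧ ∀ v' Q', N.IsFeasible v' Q' → power v Q ≤ power v' Q'

/-! ### The semidefinite relaxation in the variables `V 1, …, V K` and `Q` -/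

/-- The SINR constraint function `a_k`. -/
noncomputable def a (V : Fin K → Matrix (Fin M) (Fin M) ℂ) (Q : Matrix (Fin M) (Fin M) ℂ)
    (k : Fin K) : ℝ :=
  1 / N.γ k * qform (N.h k) (V k) - ∑ j ∈ Finset.univ.erase k, qform (N.h k) (V j)
    - qform (N.h k) Q - N.σ k ^ 2

/-- The fronthaul constraint function `B_m`. -/
noncomputable def B (V : Fin K → Matrix (Fin M) (Fin M) ℂ) (Q : Matrix (Fin M) (Fin M) ℂ)
    (m : Fin M) : Matrix (Fin M) (Fin M) ℂ :=
  (N.η m : ℂ) • tailBlock m Q - (∑ k, V k m m + Q m m) • E m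

/-- Strict feasibility of the semidefinite relaxation: some point satisfies every inequality
strictly. Rows and columns `1, …, m - 1` of `B_m` vanish identically, so the `m`-th fronthaul
constraint is a linear matrix inequality on the block `(m:M, m:M)`, and it is this block that has
to be positive definite. -/
def StrictlyFeasible : Prop :=
  ∃ (V : Fin K → Matrix (Fin M) (Fin M) ℂ) (Q : Matrix (Fin M) (Fin M) ℂ),
    (∀ k, (V k).PosDef) ∧ Q.PosDef ∧ (∀ k, 0 < N.a V Q k) ∧
    ∀ m, ((N.B V Q m).submatrix (Subtype.val : {i : Fin M // m ≤ i} → Fin M)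
      (Subtype.val : {i : Fin M // m ≤ i} → Fin M)).PosDef

/-! ### Dual quantities -/

/-- `C_k(β, Λ) = I + ∑_{j ≠ k} β_j h_j h_j† + ∑_m Λ_m^(m,m) E_m`. -/
noncomputable def Cmat (β : Fin K → ℝ) (Λ : Fin M → Matrix (Fin M) (Fin M) ℂ) (k : Fin K) :
    Matrix (Fin M) (Fin M) ℂ :=
  1 + ∑ j ∈ Finset.univ.erase k, (β j : ℂ) • outer (N.h j) + ∑ m, Λ m m m • E m

/-- The dual slack matrix `C_k(β, Λ) - (β_k / γ_k) h_k h_k†`. -/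
noncomputable def slackMat (β : Fin K → ℝ) (Λ : Fin M → Matrix (Fin M) (Fin M) ℂ) (k : Fin K) :
    Matrix (Fin M) (Fin M) ℂ :=
  N.Cmat β Λ k - ((β k / N.γ k : ℝ) : ℂ) • outer (N.h k)

/-- `Γ(β) = I + ∑_k β_k h_k h_k†`. -/
noncomputable def Γ (β : Fin K → ℝ) : Matrix (Fin M) (Fin M) ℂ :=
  1 + ∑ k, (β k : ℂ) • outer (N.h k)

/-- `D(β, Λ) = I + ∑_k β_k h_k h_k† + ∑_m Λ_m^(m,m) E_m
  - ∑_m 2^(C_m) [0, 0; 0, Λ_m^(m:M, m:M)]`. -/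
noncomputable def D (β : Fin K → ℝ) (Λ : Fin M → Matrix (Fin M) (Fin M) ℂ) :
    Matrix (Fin M) (Fin M) ℂ :=
  N.Γ β + ∑ m, Λ m m m • E m - ∑ m, (N.η m : ℂ) • tailBlock m (Λ m)

/-- The enhanced KKT conditions of the semidefinite relaxation. -/
structure EnhancedKKT (V : Fin K → Matrix (Fin M) (Fin M) ℂ) (Q : Matrix (Fin M) (Fin M) ℂ)
    (β : Fin K → ℝ) (Λ : Fin M → Matrix (Fin M) (Fin M) ℂ) : Prop where
  slack_V : ∀ k, (V k * N.slackMat β Λ k).trace = 0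
  slack_B : ∀ m, (Λ m * N.B V Q m).trace = 0
  dual_D : N.D β Λ = 0
  dual_rank : ∀ m, (Λ m).rank ≤ 1
  dual_psd : ∀ m, (Λ m).PosSemidef
  dual_support : ∀ m i j, (i < m ∨ j < m) → Λ m i j = 0
  dual_nonneg : ∀ k, 0 ≤ β k
  dual_slack_rank : ∀ k, (N.slackMat β Λ k).rank + 1 = M
  dual_slack_psd : ∀ k, (N.slackMat β Λ k).PosSemidef
  primal_psd : ∀ k, (V k).PosSemidef
  primal_rank : ∀ k, (V k).rank = 1
  primal_sinr : ∀ k, N.a V Q k = 0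
  primal_fronthaul : ∀ m, (N.B V Q m).PosSemidef
  primal_cov : Q.PosSemidef

/-! ### The dual fixed point iteration -/

/-- The matrix `Λ_m` computed from the current right-hand side `G = Γ_m`: the rank-one matrix
supported on the block `(m:M, m:M)` whose `m`-th row is
`[G^(m,m) / (2^(C_m) - 1), G^(m,m+1:M) / 2^(C_m)]`. -/
noncomputable def lambdaOf (m : Fin M) (G : Matrix (Fin M) (Fin M) ℂ) :
    Matrix (Fin M) (Fin M) ℂ :=
  Matrix.of fun i j =>
    if i < m ∨ j < m then 0
    else if i = m ∧ j = m then G m m / ((N.η m : ℂ) - 1)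
    else if i = m ∨ j = m then G i j / (N.η m : ℂ)
    else ((N.η m : ℂ) - 1) / (N.η m : ℂ) ^ 2 * (G i m * G m j / G m m)

/-- `gammaSeq β n` is what is left of the right-hand side `Γ(β)` after the first `n` of the
matrices `Λ_m` have been computed and their terms subtracted. -/
noncomputable def gammaSeq (β : Fin K → ℝ) : ℕ → Matrix (Fin M) (Fin M) ℂ
  | 0 => N.Γ β
  | n + 1 =>
    if hn : n < M then
      gammaSeq β n -
        ((N.η ⟨n, hn⟩ : ℂ) • tailBlock ⟨n, hn⟩ (N.lambdaOf ⟨n, hn⟩ (gammaSeq β n)) -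
          N.lambdaOf ⟨n, hn⟩ (gammaSeq β n) ⟨n, hn⟩ ⟨n, hn⟩ • E ⟨n, hn⟩)
    else gammaSeq β n

/-- The matrices `Λ_m(β)`. -/
noncomputable def Λof (β : Fin K → ℝ) (m : Fin M) : Matrix (Fin M) (Fin M) ℂ :=
  N.lambdaOf m (N.gammaSeq β m)

/-- The dual fixed point map, `I_k(β) = γ_k / (h_k† C_k(β, Λ(β))⁻¹ h_k)`. -/
noncomputable def dualMap (β : Fin K → ℝ) : Fin K → ℝ := fun k =>
  N.γ k / qform (N.h k) (N.Cmat β (N.Λof β) k)⁻¹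

/-! ### The primal fixed point iteration, for given dual variables `β` and `Λ(β)` -/

/-- The unit vector `C_k⁻¹ h_k / ‖C_k⁻¹ h_k‖` (Euclidean norm). -/
noncomputable def direction (β : Fin K → ℝ) (k : Fin K) : Fin M → ℂ :=
  (((‖WithLp.toLp 2 ((N.Cmat β (N.Λof β) k)⁻¹ *ᵥ N.h k)‖⁻¹ : ℝ)) : ℂ) •
    ((N.Cmat β (N.Λof β) k)⁻¹ *ᵥ N.h k)

/-- The rank-one matrix built from `direction`. -/
noncomputable def Vhat (β : Fin K → ℝ) (k : Fin K) : Matrix (Fin M) (Fin M) ℂ :=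
  outer (N.direction β k)

/-- The vector `λ_m` with `Λ_m(β) = λ_m λ_m†`, normalized so that `λ_m^(m) > 0`. (Only the quotients
of entries of `λ_m` matter below, so the choice of the phase is irrelevant.) -/
noncomputable def lam (β : Fin K → ℝ) (m : Fin M) : Fin M → ℂ := fun i =>
  N.Λof β m i m / (Real.sqrt (N.Λof β m m m).re : ℂ)

/-- One step of the back substitution: fill in row and column `m` of `Q`, when the entries of `Q`
with both indices larger than `m` are known. -/
noncomputable def fillQ (β p : Fin K → ℝ) (m : Fin M) (Q : Matrix (Fin M) (Fin M) ℂ) :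
    Matrix (Fin M) (Fin M) ℂ :=
  Matrix.of fun i j =>
    if i = m ∧ j = m then
      (N.η m : ℂ) / ((N.η m : ℂ) - 1) *
          ((∑ r ∈ Finset.Ioi m, ∑ s ∈ Finset.Ioi m,
            star (N.lam β m r) * Q r s * N.lam β m s) / ((‖N.lam β m m‖ ^ 2 : ℝ) : ℂ))
        + 1 / ((N.η m : ℂ) - 1) * ∑ k, (p k : ℂ) * N.Vhat β k m m
    else if j = m ∧ m < i then -(∑ s ∈ Finset.Ioi m, Q i s * N.lam β m s) / N.lam β m m
    else if i = m ∧ m < j then star (-(∑ s ∈ Finset.Ioi m, Q j s * N.lam β m s) / N.lam β m m)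
    else Q i j

/-- The matrix after `n` back substitution steps, taken in the order `m = M, M - 1, …`. -/
noncomputable def qSeq (β p : Fin K → ℝ) : ℕ → Matrix (Fin M) (Fin M) ℂ
  | 0 => 0
  | n + 1 => if hn : n < M then N.fillQ β p (Fin.rev ⟨n, hn⟩) (qSeq β p n) else qSeq β p n

/-- The compression covariance matrix `Q(p)`. -/
noncomputable def Qof (β p : Fin K → ℝ) : Matrix (Fin M) (Fin M) ℂ := N.qSeq β p M

/-- The primal fixed point map `J`, for given `β`. -/
noncomputable def primalMap (β p : Fin K → ℝ) : Fin K → ℝ := fun k =>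
  N.γ k * (∑ j ∈ Finset.univ.erase k, p j * qform (N.h k) (N.Vhat β j)
      + qform (N.h k) (N.Qof β p) + N.σ k ^ 2) /
    qform (N.h k) (N.Vhat β k)

/-- The matrices `V_k = p_k v̂_k v̂_k†`. -/
noncomputable def Vof (β p : Fin K → ℝ) (k : Fin K) : Matrix (Fin M) (Fin M) ℂ :=
  (p k : ℂ) • N.Vhat β k

end RelayNetwork

/-!
Both fixed point maps are standard interference functions (positive, monotone, strictly
subhomogeneous on the nonnegative orthant). Such a map `f` for which `{x ≥ 0 | x ≤ f x}` is bounded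
has a positive fixed point, which attracts every nonnegative starting point
(`IsStandardInterference.exists_fixed`). Lagrangian duality supplies the two bounds.

*Dual map.* The step from `Γ_m` to `Γ_{m+1}` clears row and column `m`, and the quadratic form of the
result at `x` is the minimum over `t` of
`η⁻¹ Γ_m[x with x_m = 0] + (1 - η⁻¹) Γ_m[x with x_m = t]` (`qform_reduce_le`,
`exists_qform_reduce_eq`). Hence each step is monotone in the Loewner order, it is homogeneous, and
it preserves definiteness on the remaining block. After `M` steps nothing is left, that is, `D = 0`.
As `Γ(αβ) ≤ α Γ(β)` for `α ≥ 1`, the matrices `C_k(β, Λ(β))` are monotone and strictly subhomogeneous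
in `β`, and by the Cauchy–Schwarz inequality `|h† x|² ≤ (h† C⁻¹ h)(x† C x)` so is the dual map.
The same inequality shows that `β ≤ I(β)` makes the slack matrices `S_k` positive semidefinite. Then
`(β, Λ(β))` is dual feasible, and weak duality bounds `∑ β_k σ_k²` by the power of a feasible point.

*Primal map.* The back substitution makes `B_m` equal to `η_m Tᴴ q T`, where `q` is the part of `Q(p)`
already computed and `T = 1 - λ_m e_m† / λ_m^(m)` kills `λ_m` (`smul_fillQ_sub`). So `Q(p)` and all
`B_m` are positive semidefinite, `tr (Λ_m B_m) = 0`, and `Q(p)` is linear in `p`; therefore the primal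
map is affine with nonnegative coefficients. At a dual fixed point `C_k⁻¹ h_k` spans the kernel of
`S_k`, hence for every `p ≥ 0` all terms of the Lagrangian identity `lagrangian_eq` vanish except
`∑ p_k + tr Q(p) = ∑ β_k a_k + ∑ β_k σ_k²`. Since `p ≤ J(p)` means `a_k ≤ 0`, such `p` are bounded.

At the two fixed points the KKT conditions hold, and problem (P) is the relaxation restricted to
rank-one `V_k`, so weak duality gives global optimality.
-/

/-! ### Standard interference functions -/

/-- A *standard interference function*: a self-map of the nonnegative orthant that is positive,
monotone and strictly subhomogeneous. -/
structure IsStandardInterference {ι : Type*} (f : (ι → ℝ) → ι → ℝ) : Prop where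
  pos : ∀ x, 0 ≤ x → ∀ k, 0 < f x k
  mono : ∀ x y, 0 ≤ x → x ≤ y → f x ≤ f y
  scale : ∀ x, 0 ≤ x → ∀ α : ℝ, 1 < α → ∀ k, f (α • x) k < α * f x k

namespace IsStandardInterference

variable {ι : Type*} {f : (ι → ℝ) → ι → ℝ}

/-- Monotonicity and subhomogeneity force continuity at positive points: near `x`, a point is
squeezed between `α⁻¹ • x` and `α • x`. -/
theorem tendsto_comp [Finite ι] (hf : IsStandardInterference f) {u : ℕ → ι → ℝ} {x : ι → ℝ}
    (hu : ∀ n, 0 ≤ u n) (hx : ∀ k, 0 < x k) (h : Tendsto u atTop (𝓝 x)) :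
    Tendsto (fun n => f (u n)) atTop (𝓝 (f x)) := by
  have hx0 : 0 ≤ x := fun k => (hx k).le
  rw [tendsto_pi_nhds] at h ⊢
  intro k
  have hfx := hf.pos x hx0 k
  refine tendsto_order.2 ⟨fun a ha => ?_, fun a ha => ?_⟩
  · obtain ⟨α, hα, ha'⟩ : ∃ α : ℝ, 1 < α ∧ α * a < f x k := by
      have : Tendsto (fun α : ℝ => α * a) (𝓝[>] 1) (𝓝 (1 * a)) :=
        ((continuous_id.mul continuous_const).tendsto 1).mono_left nhdsWithin_le_nhds
      rw [one_mul] at this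
      obtain ⟨α, h1, h2⟩ := ((this.eventually (gt_mem_nhds ha)).and self_mem_nhdsWithin).exists
      exact ⟨α, h2, h1⟩
    have hev : ∀ᶠ n in atTop, ∀ i, x i ≤ α * u n i := by
      refine eventually_all.2 fun i => ?_
      have : Tendsto (fun n => α * u n i) atTop (𝓝 (α * x i)) := (h i).const_mul α
      exact (this.eventually (lt_mem_nhds (by nlinarith [hx i]))).mono fun n hn => hn.le
    filter_upwards [hev] with n hn
    have h1 := hf.mono x (α • u n) hx0 hn k
    have h2 := hf.scale (u n) (hu n) α hα k
    nlinarith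
  · obtain ⟨α, hα, ha'⟩ : ∃ α : ℝ, 1 < α ∧ α * f x k < a := by
      have : Tendsto (fun α : ℝ => α * f x k) (𝓝[>] 1) (𝓝 (1 * f x k)) :=
        ((continuous_id.mul continuous_const).tendsto 1).mono_left nhdsWithin_le_nhds
      rw [one_mul] at this
      obtain ⟨α, h1, h2⟩ := ((this.eventually (gt_mem_nhds ha)).and self_mem_nhdsWithin).exists
      exact ⟨α, h2, h1⟩
    have hev : ∀ᶠ n in atTop, ∀ i, u n i ≤ α * x i := by
      refine eventually_all.2 fun i => ?_
      exact ((h i).eventually (gt_mem_nhds (by nlinarith [hx i]))).mono fun n hn => hn.le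
    filter_upwards [hev] with n hn
    have h1 := hf.mono (u n) (α • x) (hu n) hn k
    have h2 := hf.scale x hx0 α hα k
    linarith

theorem nonneg_iterate (hf : IsStandardInterference f) {x : ι → ℝ} (hx : 0 ≤ x) (n : ℕ) :
    0 ≤ f^[n] x := by
  cases n with
  | zero => exact hx
  | succ n =>
    induction n generalizing x with
    | zero => exact fun k => (hf.pos x hx k).le
    | succ n ih => exact ih (x := f x) fun k => (hf.pos x hx k).le

theorem iterate_mono (hf : IsStandardInterference f) {x y : ι → ℝ} (hx : 0 ≤ x) (hxy : x ≤ y)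
    (n : ℕ) : f^[n] x ≤ f^[n] y := by
  induction n generalizing x y with
  | zero => exact hxy
  | succ n ih => exact ih (fun k => (hf.pos x hx k).le) (hf.mono x y hx hxy)

/-- A positive limit of an iteration is a fixed point. -/
theorem fixed_of_tendsto [Finite ι] (hf : IsStandardInterference f) {x y : ι → ℝ} (hx : 0 ≤ x)
    (hy : ∀ k, 0 < y k) (h : Tendsto (fun n => f^[n] x) atTop (𝓝 y)) : f y = y := by
  have h1 := hf.tendsto_comp (fun n => hf.nonneg_iterate hx n) hy h
  have h2 := (tendsto_add_atTop_iff_nat 1).2 h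
  simp only [Function.iterate_succ_apply'] at h2
  exact tendsto_nhds_unique h1 h2

theorem fixed_pos (hf : IsStandardInterference f) {b : ι → ℝ} (hb : 0 ≤ b) (hfix : f b = b)
    (k : ι) : 0 < b k := by
  have := hf.pos b hb k
  rwa [hfix] at this

/-- Of two fixed points, neither exceeds the other: at an index where the ratio of the coordinates
is largest, a ratio above `1` would contradict strict subhomogeneity. -/
theorem fixed_le [Finite ι] (hf : IsStandardInterference f) {b y : ι → ℝ} (hb : 0 ≤ b) (hy : 0 ≤ y)
    (hfb : f b = b) (hfy : f y = y) : y ≤ b := by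
  intro i
  have hbp := hf.fixed_pos hb hfb
  have : Nonempty ι := ⟨i⟩
  obtain ⟨k, hk⟩ := Finite.exists_max fun k => y k / b k
  by_contra! hlt
  set α := y k / b k with hα
  have hα1 : 1 < α := lt_of_lt_of_le ((one_lt_div (hbp i)).2 hlt) (hk i)
  have hle : y ≤ α • b := fun j => (div_le_iff₀ (hbp j)).1 (hk j)
  have h1 := hf.mono y (α • b) hy hle k
  have h2 := hf.scale b hb α hα1 k
  rw [hfy] at h1
  rw [hfb] at h2
  have h3 : α * b k = y k := div_mul_cancel₀ _ (hbp k).ne'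
  linarith

/-- If the set of points `x ≤ f x` is bounded, then `f` has a positive fixed point, and the
iteration of `f` converges to it from every nonnegative starting point. -/
theorem exists_fixed [Finite ι] (hf : IsStandardInterference f)
    (hB : ∃ B : ℝ, ∀ x, 0 ≤ x → x ≤ f x → ∀ k, x k ≤ B) :
    ∃ b : ι → ℝ, f b = b ∧ (∀ k, 0 < b k) ∧
      ∀ x, 0 ≤ x → Tendsto (fun n : ℕ => f^[n] x) atTop (𝓝 b) := by
  obtain ⟨B, hB⟩ := hB
  have h0 : (0 : ι → ℝ) ≤ f 0 := fun k => (hf.pos 0 le_rfl k).le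
  have hinc : Monotone fun n => f^[n] (0 : ι → ℝ) := by
    refine monotone_nat_of_le_succ fun n => ?_
    rw [Function.iterate_succ_apply]
    exact hf.iterate_mono le_rfl h0 n
  have hbd : ∀ k, BddAbove (Set.range fun n => f^[n] (0 : ι → ℝ) k) := by
    rintro k
    refine ⟨B, ?_⟩
    rintro _ ⟨n, rfl⟩
    refine hB _ (hf.nonneg_iterate le_rfl n) ?_ k
    rw [← Function.iterate_succ_apply' f]
    exact hinc n.le_succ
  set b : ι → ℝ := fun k => ⨆ n, f^[n] (0 : ι → ℝ) k with hbdef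
  have hb : Tendsto (fun n => f^[n] (0 : ι → ℝ)) atTop (𝓝 b) :=
    tendsto_pi_nhds.2 fun k => tendsto_atTop_ciSup (fun m n h => hinc h k) (hbd k)
  have hbp : ∀ k, 0 < b k := fun k =>
    lt_of_lt_of_le (hf.pos 0 le_rfl k) (le_ciSup (hbd k) 1)
  have hb0 : 0 ≤ b := fun k => (hbp k).le
  have hfix := hf.fixed_of_tendsto le_rfl hbp hb
  refine ⟨b, hfix, hbp, fun x hx => ?_⟩
  -- a multiple of the fixed point that dominates the starting point
  obtain ⟨α, hα1, hα⟩ : ∃ α : ℝ, 1 < α ∧ x ≤ α • b := by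
    obtain ⟨R, hR⟩ := (Set.finite_range fun k => x k / b k).bddAbove
    refine ⟨max R 2, by norm_num, fun k => ?_⟩
    have : x k / b k ≤ max R 2 := (hR ⟨k, rfl⟩).trans (le_max_left _ _)
    exact (div_le_iff₀ (hbp k)).1 this
  have hαb : b ≤ α • b := fun k => by
    have := hbp k
    simp only [Pi.smul_apply, smul_eq_mul]
    nlinarith
  have hα0 : 0 ≤ α • b := hb0.trans hαb
  have hdec : Antitone fun n => f^[n] (α • b) := by
    refine antitone_nat_of_succ_le fun n => ?_
    rw [Function.iterate_succ_apply]
    refine hf.iterate_mono (fun k => (hf.pos _ hα0 k).le) (fun k => ?_) n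
    have := hf.scale b hb0 α hα1 k
    rw [hfix] at this
    exact this.le
  have hlow : ∀ n, b ≤ f^[n] (α • b) := fun n => by
    have := hf.iterate_mono hb0 hαb n
    rwa [Function.iterate_fixed hfix] at this
  have hbd' : ∀ k, BddBelow (Set.range fun n => f^[n] (α • b) k) := by
    rintro k
    refine ⟨b k, ?_⟩
    rintro _ ⟨n, rfl⟩
    exact hlow n k
  set y : ι → ℝ := fun k => ⨅ n, f^[n] (α • b) k with hydef
  have hy : Tendsto (fun n => f^[n] (α • b)) atTop (𝓝 y) :=
    tendsto_pi_nhds.2 fun k => tendsto_atTop_ciInf (fun m n h => hdec h k) (hbd' k)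
  have hby : b ≤ y := fun k => le_ciInf fun n => hlow n k
  have hyp : ∀ k, 0 < y k := fun k => (hbp k).trans_le (hby k)
  have hyfix := hf.fixed_of_tendsto hα0 hyp hy
  have hyb : y = b := le_antisymm (hf.fixed_le hb0 (hb0.trans hby) hfix hyfix) hby
  rw [hyb] at hy
  rw [tendsto_pi_nhds] at hb hy ⊢
  exact fun k => tendsto_of_tendsto_of_tendsto_of_le_of_le (hb k) (hy k)
    (fun n => hf.iterate_mono le_rfl hx n k) (fun n => hf.iterate_mono hx hα n k)

end IsStandardInterference

namespace RelayNetwork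

variable {M K : ℕ}

/-! ### Hermitian forms -/

theorem qform_add (x : Fin M → ℂ) (A B : Matrix (Fin M) (Fin M) ℂ) :
    qform x (A + B) = qform x A + qform x B := by
  simp [qform, add_mulVec]

theorem qform_sub (x : Fin M → ℂ) (A B : Matrix (Fin M) (Fin M) ℂ) :
    qform x (A - B) = qform x A - qform x B := by
  simp [qform, sub_mulVec]

theorem qform_smul (x : Fin M → ℂ) (c : ℝ) (A : Matrix (Fin M) (Fin M) ℂ) :
    qform x ((c : ℂ) • A) = c * qform x A := by
  simp [qform, smul_mulVec]

theorem qform_zero (x : Fin M → ℂ) : qform x (0 : Matrix (Fin M) (Fin M) ℂ) = 0 := by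
  simp [qform]

theorem qform_sum {ι : Type*} (s : Finset ι) (x : Fin M → ℂ)
    (A : ι → Matrix (Fin M) (Fin M) ℂ) : qform x (∑ i ∈ s, A i) = ∑ i ∈ s, qform x (A i) := by
  classical
  induction s using Finset.induction_on with
  | empty => simp [qform_zero]
  | insert i s hi ih => rw [Finset.sum_insert hi, Finset.sum_insert hi, qform_add, ih]

theorem star_dotProduct_self (x : Fin M → ℂ) : star x ⬝ᵥ x = ((∑ i, ‖x i‖ ^ 2 : ℝ) : ℂ) := by
  simp [dotProduct, Complex.conj_mul']

theorem qform_one (x : Fin M → ℂ) : qform x 1 = ∑ i, ‖x i‖ ^ 2 := by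
  rw [qform, one_mulVec, star_dotProduct_self, Complex.ofReal_re]

theorem star_dotProduct_comm (x y : Fin M → ℂ) : star x ⬝ᵥ y = star (star y ⬝ᵥ x) := by
  rw [star_dotProduct, dotProduct_comm]

theorem qform_outer (x y : Fin M → ℂ) : qform x (outer y) = ‖star x ⬝ᵥ y‖ ^ 2 := by
  rw [qform, outer, vecMulVec_mulVec, star_dotProduct_comm y x, dotProduct_smul]
  simp only [MulOpposite.smul_eq_mul_unop, MulOpposite.unop_op]
  rw [Complex.star_def, Complex.mul_conj', ← Complex.ofReal_pow, Complex.ofReal_re]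

theorem qform_smul_E (x : Fin M → ℂ) (c : ℂ) (m : Fin M) :
    qform x (c • E m) = c.re * ‖x m‖ ^ 2 := by
  have : star x ⬝ᵥ ((c • E m) *ᵥ x) = c * ((‖x m‖ ^ 2 : ℝ) : ℂ) := by
    rw [smul_mulVec, dotProduct_smul, E, single_mulVec, dotProduct_comm]
    simp [Function.update_apply, dotProduct, Complex.mul_conj']
  rw [qform, this, Complex.re_mul_ofReal]

theorem isHermitian_smul_ofReal {A : Matrix (Fin M) (Fin M) ℂ} (hA : A.IsHermitian) (c : ℝ) :
    ((c : ℂ) • A).IsHermitian := by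
  rw [IsHermitian, conjTranspose_smul, hA.eq]; simp

theorem isHermitian_outer (x : Fin M → ℂ) : (outer x).IsHermitian := by
  rw [outer, IsHermitian, conjTranspose_vecMulVec, star_star]

/-- The Hermitian form of a Hermitian matrix is real. -/
theorem dotProduct_mulVec_eq_qform {A : Matrix (Fin M) (Fin M) ℂ} (hA : A.IsHermitian)
    (x : Fin M → ℂ) : star x ⬝ᵥ (A *ᵥ x) = (qform x A : ℂ) := by
  refine (Complex.conj_eq_iff_re.1 ?_).symm
  have := hA.im_star_dotProduct_mulVec_self x
  exact Complex.conj_eq_iff_im.2 this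

theorem posSemidef_of_qform {A : Matrix (Fin M) (Fin M) ℂ} (hA : A.IsHermitian)
    (h : ∀ x, 0 ≤ qform x A) : A.PosSemidef :=
  .of_dotProduct_mulVec_nonneg hA fun x => by
    rw [dotProduct_mulVec_eq_qform hA]; exact_mod_cast h x

theorem posDef_of_qform {A : Matrix (Fin M) (Fin M) ℂ} (hA : A.IsHermitian)
    (h : ∀ x, x ≠ 0 → 0 < qform x A) : A.PosDef :=
  .of_dotProduct_mulVec_pos hA fun x hx => by
    rw [dotProduct_mulVec_eq_qform hA]; exact_mod_cast h x hx

theorem qform_nonneg {A : Matrix (Fin M) (Fin M) ℂ} (hA : A.PosSemidef) (x : Fin M → ℂ) :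
    0 ≤ qform x A := hA.re_dotProduct_nonneg x

theorem posSemidef_outer (x : Fin M → ℂ) : (outer x).PosSemidef :=
  posSemidef_vecMulVec_self_star x

theorem trace_outer_mul (x : Fin M → ℂ) (A : Matrix (Fin M) (Fin M) ℂ) :
    (outer x * A).trace = star x ⬝ᵥ (A *ᵥ x) := by
  rw [outer, vecMulVec_mul, trace_vecMulVec, dotProduct_comm, dotProduct_mulVec]

theorem sum_norm_sq_pos {x : Fin M → ℂ} (hx : x ≠ 0) : 0 < ∑ i, ‖x i‖ ^ 2 := by
  obtain ⟨i, hi⟩ := Function.ne_iff.1 hx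
  have hi : x i ≠ 0 := hi
  exact Finset.sum_pos' (fun i _ => by positivity) ⟨i, Finset.mem_univ i, by positivity⟩

/-- The trace of a product of positive semidefinite matrices is nonnegative. -/
theorem trace_mul_nonneg {A B : Matrix (Fin M) (Fin M) ℂ} (hA : A.PosSemidef)
    (hB : B.PosSemidef) : 0 ≤ (A * B).trace.re := by
  obtain ⟨X, rfl⟩ : ∃ X : Matrix (Fin M) (Fin M) ℂ, A = Xᴴ * X := by
    open scoped MatrixOrder in
    exact CStarAlgebra.nonneg_iff_eq_star_mul_self.1 hA.nonneg
  rw [Matrix.mul_assoc, trace_mul_comm]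
  exact (Complex.le_def.1 (hB.mul_mul_conjTranspose_same X).trace_nonneg).1

/-! ### Forms of inverse matrices -/

section Inverse

variable {A B : Matrix (Fin M) (Fin M) ℂ} {h : Fin M → ℂ}

theorem mul_inv_mulVec (hA : A.PosDef) (h : Fin M → ℂ) : A *ᵥ (A⁻¹ *ᵥ h) = h := by
  rw [mulVec_mulVec, mul_nonsing_inv _ ((isUnit_iff_isUnit_det A).1 hA.isUnit), one_mulVec]

theorem qform_inv_eq (hA : A.PosDef) (h : Fin M → ℂ) :
    qform (A⁻¹ *ᵥ h) A = qform h A⁻¹ := by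
  rw [qform, mul_inv_mulVec hA, qform, star_dotProduct_comm]
  simp

theorem qform_inv_pos (hA : A.PosDef) (hh : h ≠ 0) : 0 < qform h A⁻¹ :=
  hA.inv.re_dotProduct_pos hh

theorem qform_inv_ofReal (hA : A.PosDef) (h : Fin M → ℂ) :
    star h ⬝ᵥ (A⁻¹ *ᵥ h) = (qform h A⁻¹ : ℂ) :=
  dotProduct_mulVec_eq_qform hA.inv.isHermitian h

theorem star_dotProduct_mulVec_comm (hA : A.IsHermitian) (x y : Fin M → ℂ) :
    star x ⬝ᵥ (A *ᵥ y) = star (star y ⬝ᵥ (A *ᵥ x)) := by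
  rw [star_dotProduct_comm, star_mulVec, hA.eq, dotProduct_mulVec]

/-- Expansion of a Hermitian form along a line. -/
theorem qform_add_smul (hA : A.IsHermitian) (x y : Fin M → ℂ) (t : ℂ) :
    qform (x + t • y) A =
      qform x A + 2 * (star t * (star y ⬝ᵥ (A *ᵥ x))).re + ‖t‖ ^ 2 * qform y A := by
  have h1 := star_dotProduct_mulVec_comm hA x y
  have h2 := dotProduct_mulVec_eq_qform hA y
  have h3 : star t * t = ((‖t‖ ^ 2 : ℝ) : ℂ) := by simp [Complex.conj_mul']
  have : star (x + t • y) ⬝ᵥ (A *ᵥ (x + t • y)) =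
      star x ⬝ᵥ (A *ᵥ x) + (star (star t * (star y ⬝ᵥ (A *ᵥ x))) +
        star t * (star y ⬝ᵥ (A *ᵥ x))) + ((‖t‖ ^ 2 * qform y A : ℝ) : ℂ) := by
    rw [Complex.ofReal_mul, ← h3, ← h2, star_mul', star_star, ← h1]
    simp only [mulVec_add, mulVec_smul, star_add, star_smul, add_dotProduct, dotProduct_add,
      smul_dotProduct, dotProduct_smul, smul_eq_mul]
    ring
  rw [qform, this]
  simp only [Complex.add_re, Complex.ofReal_re, Complex.star_def, Complex.conj_re, qform]
  ring

/-- Cauchy–Schwarz inequality: `|h† x|² ≤ (h† A⁻¹ h) (x† A x)`. -/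
theorem norm_sq_dotProduct_le (hA : A.PosDef) (h x : Fin M → ℂ) :
    ‖star h ⬝ᵥ x‖ ^ 2 ≤ qform h A⁻¹ * qform x A := by
  rcases eq_or_ne h 0 with rfl | hh
  · simp [qform]
  have hc := qform_inv_pos hA hh
  have hu : star (A⁻¹ *ᵥ h) ⬝ᵥ (A *ᵥ x) = star h ⬝ᵥ x := by
    rw [star_dotProduct_mulVec_comm hA.isHermitian, mul_inv_mulVec hA, ← star_dotProduct_comm]
  -- the choice of `t` that minimizes the form on the line `x + t A⁻¹ h`
  have h1 := qform_add_smul hA.isHermitian x (A⁻¹ *ᵥ h) (-((star h ⬝ᵥ x) / (qform h A⁻¹ : ℂ)))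
  have h2 := qform_nonneg hA.posSemidef (x + (-((star h ⬝ᵥ x) / (qform h A⁻¹ : ℂ))) • A⁻¹ *ᵥ h)
  rw [hu, qform_inv_eq hA] at h1
  generalize star h ⬝ᵥ x = z at *
  generalize qform h A⁻¹ = c at *
  have h3 : star (-(z / (c : ℂ))) * z = ((-(‖z‖ ^ 2 / c) : ℝ) : ℂ) := by
    have : star z * z = ((‖z‖ ^ 2 : ℝ) : ℂ) := by simp [Complex.conj_mul']
    rw [star_neg, star_div₀, show star (c : ℂ) = c from Complex.conj_ofReal c, neg_mul, div_mul_eq_mul_div,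
      this]
    push_cast; ring
  have h4 : ‖-(z / (c : ℂ))‖ ^ 2 * c = ‖z‖ ^ 2 / c := by
    rw [norm_neg, norm_div, Complex.norm_real, Real.norm_of_nonneg hc.le]
    field_simp
  rw [h3, h4, Complex.ofReal_re] at h1
  have h5 : ‖z‖ ^ 2 / c ≤ qform x A := by linarith
  rwa [div_le_iff₀' hc] at h5

/-- The form of the inverse is antitone; the hypothesis is needed at one vector only. -/
theorem qform_inv_lt (hA : A.PosDef) (hB : B.PosDef) (hh : h ≠ 0)
    (hlt : qform (B⁻¹ *ᵥ h) A < qform (B⁻¹ *ᵥ h) B) : qform h B⁻¹ < qform h A⁻¹ := by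
  have h1 := norm_sq_dotProduct_le hA h (B⁻¹ *ᵥ h)
  have hb := qform_inv_pos hB hh
  have ha := qform_inv_pos hA hh
  rw [qform_inv_ofReal hB, Complex.norm_real, Real.norm_eq_abs, sq_abs] at h1
  rw [qform_inv_eq hB] at hlt
  nlinarith

theorem qform_inv_le (hA : A.PosDef) (hB : B.PosDef)
    (hle : qform (B⁻¹ *ᵥ h) A ≤ qform (B⁻¹ *ᵥ h) B) : qform h B⁻¹ ≤ qform h A⁻¹ := by
  rcases eq_or_ne h 0 with rfl | hh
  · simp [qform]
  have h1 := norm_sq_dotProduct_le hA h (B⁻¹ *ᵥ h)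
  have hb := qform_inv_pos hB hh
  have ha := qform_inv_pos hA hh
  rw [qform_inv_ofReal hB, Complex.norm_real, Real.norm_eq_abs, sq_abs] at h1
  rw [qform_inv_eq hB] at hle
  nlinarith

end Inverse

variable (N : RelayNetwork M K)

/-! ### One elimination step of the dual recursion -/

/-- `G` is Hermitian, vanishes outside the block of indices at least `n`, and is positive definite
on that block. -/
structure TailPosDef (n : ℕ) (G : Matrix (Fin M) (Fin M) ℂ) : Prop where
  herm : G.IsHermitian
  supp : ∀ i j : Fin M, ((i : ℕ) < n ∨ (j : ℕ) < n) → G i j = 0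
  pos : ∀ x : Fin M → ℂ, (∃ i : Fin M, n ≤ (i : ℕ) ∧ x i ≠ 0) → 0 < qform x G

/-- What is left of the right-hand side `G` after the terms of `Λ_m` have been subtracted. -/
noncomputable def reduce (m : Fin M) (G : Matrix (Fin M) (Fin M) ℂ) :
    Matrix (Fin M) (Fin M) ℂ :=
  G - ((N.η m : ℂ) • tailBlock m (N.lambdaOf m G) - N.lambdaOf m G m m • E m)

theorem gammaSeq_succ (β : Fin K → ℝ) {n : ℕ} (hn : n < M) :
    N.gammaSeq β (n + 1) = N.reduce ⟨n, hn⟩ (N.gammaSeq β n) := by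
  rw [gammaSeq, dif_pos hn, reduce]

theorem one_lt_η {m : Fin M} (hC : 0 < N.C m) : 1 < N.η m :=
  Real.one_lt_rpow (by norm_num) hC

section Step

variable {N} {m : Fin M} {G G' : Matrix (Fin M) (Fin M) ℂ}

theorem TailPosDef.qform_nonneg {n : ℕ} (hG : TailPosDef n G) (x : Fin M → ℂ) :
    0 ≤ qform x G := by
  by_cases hx : ∃ i : Fin M, n ≤ (i : ℕ) ∧ x i ≠ 0
  · exact (hG.pos x hx).le
  · push Not at hx
    have : G *ᵥ x = 0 := by
      funext i
      rw [mulVec, Pi.zero_apply]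
      refine Finset.sum_eq_zero fun j _ => ?_
      change G i j * x j = 0
      rcases lt_or_ge (j : ℕ) n with h | h
      · rw [hG.supp i j (Or.inr h), zero_mul]
      · rw [hx j h, mul_zero]
    rw [qform, this, dotProduct_zero, Complex.zero_re]

theorem qform_single (m : Fin M) (G : Matrix (Fin M) (Fin M) ℂ) :
    qform (Pi.single m 1) G = (G m m).re := by
  simp [qform]

theorem TailPosDef.diag_pos (hG : TailPosDef (m : ℕ) G) : 0 < (G m m).re := by
  rw [← qform_single]
  exact hG.pos _ ⟨m, le_rfl, by simp⟩

theorem TailPosDef.diag_eq {n : ℕ} (hG : TailPosDef n G) (m : Fin M) :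
    G m m = ((G m m).re : ℂ) := (hG.herm.coe_re_apply_self m).symm

theorem lambdaOf_diag (m : Fin M) (G : Matrix (Fin M) (Fin M) ℂ) :
    N.lambdaOf m G m m = G m m / ((N.η m : ℂ) - 1) := by
  simp [lambdaOf]

theorem lambdaOf_diag_re (m : Fin M) (G : Matrix (Fin M) (Fin M) ℂ) :
    (N.lambdaOf m G m m).re = (G m m).re / (N.η m - 1) := by
  rw [lambdaOf_diag, ← Complex.ofReal_one, ← Complex.ofReal_sub, Complex.div_ofReal_re]

theorem reduce_apply_left (hC : 0 < N.C m) (hG : TailPosDef (m : ℕ) G) (j : Fin M) :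
    N.reduce m G m j = 0 := by
  have h0 := N.one_lt_η hC
  have h1 : (N.η m : ℂ) ≠ 0 := by exact_mod_cast (by linarith : N.η m ≠ 0)
  have h2 : (N.η m : ℂ) - 1 ≠ 0 := by exact_mod_cast (by linarith : N.η m - 1 ≠ 0)
  rcases lt_trichotomy j m with h | rfl | h
  · simp [reduce, tailBlock, E, hG.supp m j (Or.inr h), h.ne', h.not_ge]
  · simp [reduce, tailBlock, E, lambdaOf_diag]
    field_simp
    ring
  · simp [reduce, tailBlock, E, lambdaOf, h.ne, h.ne', h.le, h.not_gt]
    field_simp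
    ring

theorem reduce_apply_right (hC : 0 < N.C m) (hG : TailPosDef (m : ℕ) G) (j : Fin M) :
    N.reduce m G j m = 0 := by
  have h0 := N.one_lt_η hC
  have h1 : (N.η m : ℂ) ≠ 0 := by exact_mod_cast (by linarith : N.η m ≠ 0)
  rcases lt_trichotomy j m with h | rfl | h
  · simp [reduce, tailBlock, E, hG.supp j m (Or.inl h), h.ne', h.not_ge]
  · exact reduce_apply_left hC hG j
  · simp [reduce, tailBlock, E, lambdaOf, h.ne, h.ne', h.le, h.not_gt]
    field_simp
    ring

theorem reduce_apply (hC : 0 < N.C m) (hG : TailPosDef (m : ℕ) G) {i j : Fin M} (hi : i ≠ m)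
    (hj : j ≠ m) :
    N.reduce m G i j = G i j - (((1 - (N.η m)⁻¹) / (G m m).re : ℝ) : ℂ) * (G i m * G m j) := by
  have h0 := N.one_lt_η hC
  have h1 : (N.η m : ℂ) ≠ 0 := by exact_mod_cast (by linarith : N.η m ≠ 0)
  have hg : ((G m m).re : ℂ) ≠ 0 := by exact_mod_cast hG.diag_pos.ne'
  rcases lt_or_gt_of_ne hi with h | h
  · simp [reduce, tailBlock, E, hG.supp i j (Or.inl h), hG.supp i m (Or.inl h), h.ne', h.not_ge]
  rcases lt_or_gt_of_ne hj with h' | h'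
  · simp [reduce, tailBlock, E, hG.supp i j (Or.inr h'), hG.supp m j (Or.inr h'), h'.ne',
      h'.not_ge]
  simp [reduce, tailBlock, E, lambdaOf, h.ne, h'.ne, h.ne', h'.ne', h.le, h'.le, h.not_gt,
    h'.not_gt]
  rw [hG.diag_eq m, Complex.ofReal_re]
  field_simp

/-- The Hermitian form of the reduced matrix does not see the coordinate `m`; on the others it is
the form of `G` minus a multiple of the rank-one correction of the Schur complement. -/
theorem qform_reduce (hC : 0 < N.C m) (hG : TailPosDef (m : ℕ) G) (x : Fin M → ℂ) :
    qform x (N.reduce m G) = qform (Function.update x m 0) G -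
      (1 - (N.η m)⁻¹) / (G m m).re * ‖(G *ᵥ Function.update x m 0) m‖ ^ 2 := by
  set y := Function.update x m 0 with hy
  have hym : y m = 0 := by simp [hy]
  have hyi : ∀ i, i ≠ m → y i = x i := fun i hi => by simp [hy, hi]
  have h1 : qform x (N.reduce m G) = qform y
      (G - (((1 - (N.η m)⁻¹) / (G m m).re : ℝ) : ℂ) • outer (fun i => G i m)) := by
    rw [qform, qform]
    congr 1
    simp only [dotProduct, mulVec, Finset.mul_sum]
    refine Finset.sum_congr rfl fun i _ => Finset.sum_congr rfl fun j _ => ?_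
    by_cases hi : i = m
    · subst hi; simp [reduce_apply_left hC hG, hym]
    by_cases hj : j = m
    · subst hj; simp [reduce_apply_right hC hG, hym]
    rw [reduce_apply hC hG hi hj, hyi j hj, Pi.star_apply, Pi.star_apply, hyi i hi]
    simp only [outer, Matrix.sub_apply, Matrix.smul_apply, vecMulVec_apply, Pi.star_apply, hG.herm.apply,
      smul_eq_mul]
  rw [h1, qform_sub, qform_smul, qform_outer, star_dotProduct_comm, norm_star]
  congr 4
  simp only [dotProduct, mulVec, Pi.star_apply, hG.herm.apply]

theorem qform_update (hG : TailPosDef (m : ℕ) G) (x : Fin M → ℂ) (t : ℂ) :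
    qform (Function.update x m t) G = qform (Function.update x m 0) G +
      2 * (star t * (G *ᵥ Function.update x m 0) m).re + ‖t‖ ^ 2 * (G m m).re := by
  have : Function.update x m t = Function.update x m 0 + t • Pi.single m 1 := by
    funext i
    by_cases hi : i = m
    · subst hi; simp
    · simp [hi]
  rw [this, qform_add_smul hG.herm, qform_single]
  simp

/-- The form of the reduced matrix is bounded by a mixture of values of the form of `G` at vectors
that differ from `x` in the coordinate `m` only. -/
theorem qform_reduce_le (hC : 0 < N.C m) (hG : TailPosDef (m : ℕ) G) (x : Fin M → ℂ) (t : ℂ) :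
    qform x (N.reduce m G) ≤ (N.η m)⁻¹ * qform (Function.update x m 0) G +
      (1 - (N.η m)⁻¹) * qform (Function.update x m t) G := by
  have hη := N.one_lt_η hC
  have hη' : (N.η m)⁻¹ ≤ 1 := inv_le_one_of_one_le₀ hη.le
  rw [qform_reduce hC hG, qform_update hG x t]
  have hg := hG.diag_pos
  generalize (G *ᵥ Function.update x m 0) m = c
  generalize (G m m).re = g at *
  have key : 0 ≤ ‖c‖ ^ 2 / g + 2 * (star t * c).re + ‖t‖ ^ 2 * g := by
    have h1 : -(‖t‖ * ‖c‖) ≤ (star t * c).re := by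
      have := Complex.abs_re_le_norm (star t * c)
      rw [norm_mul, norm_star] at this
      exact (abs_le.1 this).1
    have h2 : ‖c‖ ^ 2 / g + 2 * -(‖t‖ * ‖c‖) + ‖t‖ ^ 2 * g = (‖c‖ - ‖t‖ * g) ^ 2 / g := by
      field_simp
      ring
    have h3 : 0 ≤ (‖c‖ - ‖t‖ * g) ^ 2 / g := by positivity
    linarith
  have h4 := mul_nonneg (sub_nonneg.2 hη') key
  have h5 : (1 - (N.η m)⁻¹) / g * ‖c‖ ^ 2 = (1 - (N.η m)⁻¹) * (‖c‖ ^ 2 / g) := by ring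
  rw [h5]
  linarith

/-- The bound of `qform_reduce_le` is attained. -/
theorem exists_qform_reduce_eq (hC : 0 < N.C m) (hG : TailPosDef (m : ℕ) G) (x : Fin M → ℂ) :
    ∃ t : ℂ, qform x (N.reduce m G) = (N.η m)⁻¹ * qform (Function.update x m 0) G +
      (1 - (N.η m)⁻¹) * qform (Function.update x m t) G := by
  refine ⟨-((G *ᵥ Function.update x m 0) m / ((G m m).re : ℂ)), ?_⟩
  rw [qform_reduce hC hG,
    qform_update hG x (-((G *ᵥ Function.update x m 0) m / ((G m m).re : ℂ)))]
  have hg := hG.diag_pos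
  generalize (G *ᵥ Function.update x m 0) m = c
  generalize (G m m).re = g at *
  have h3 : star (-(c / (g : ℂ))) * c = ((-(‖c‖ ^ 2 / g) : ℝ) : ℂ) := by
    have : star c * c = ((‖c‖ ^ 2 : ℝ) : ℂ) := by simp [Complex.conj_mul']
    rw [star_neg, star_div₀, show star (g : ℂ) = g from Complex.conj_ofReal g, neg_mul,
      div_mul_eq_mul_div, this]
    push_cast; ring
  have h4 : ‖-(c / (g : ℂ))‖ ^ 2 * g = ‖c‖ ^ 2 / g := by
    rw [norm_neg, norm_div, Complex.norm_real, Real.norm_of_nonneg hg.le]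
    field_simp
  rw [h3, h4, Complex.ofReal_re]
  ring

/-- The reduction step is monotone in the Loewner order, as a minimum of monotone functions. -/
theorem qform_reduce_mono (hC : 0 < N.C m) (hG : TailPosDef (m : ℕ) G)
    (hG' : TailPosDef (m : ℕ) G') (h : ∀ x, qform x G ≤ qform x G') (x : Fin M → ℂ) :
    qform x (N.reduce m G) ≤ qform x (N.reduce m G') := by
  have hη := N.one_lt_η hC
  have hη' : (N.η m)⁻¹ ≤ 1 := inv_le_one_of_one_le₀ hη.le
  obtain ⟨t, ht⟩ := exists_qform_reduce_eq hC hG' x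
  rw [ht]
  refine (qform_reduce_le hC hG x t).trans ?_
  exact add_le_add (mul_le_mul_of_nonneg_left (h _) (by positivity))
    (mul_le_mul_of_nonneg_left (h _) (sub_nonneg.2 hη'))

theorem TailPosDef.reduce (hC : 0 < N.C m) (hG : TailPosDef (m : ℕ) G) :
    TailPosDef ((m : ℕ) + 1) (N.reduce m G) where
  herm := by
    refine IsHermitian.ext fun i j => ?_
    by_cases hi : i = m
    · subst hi; simp [reduce_apply_left hC hG, reduce_apply_right hC hG]
    by_cases hj : j = m
    · subst hj; simp [reduce_apply_left hC hG, reduce_apply_right hC hG]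
    rw [reduce_apply hC hG hi hj, reduce_apply hC hG hj hi, star_sub, star_mul', star_mul',
      hG.herm.apply, hG.herm.apply, hG.herm.apply, mul_comm (G m j)]
    congr 2
    exact Complex.conj_ofReal _
  supp := by
    intro i j hij
    by_cases hi : i = m
    · subst hi; exact reduce_apply_left hC hG j
    by_cases hj : j = m
    · subst hj; exact reduce_apply_right hC hG i
    rw [reduce_apply hC hG hi hj]
    have hi' : (i : ℕ) ≠ m := fun h => hi (Fin.ext h)
    have hj' : (j : ℕ) ≠ m := fun h => hj (Fin.ext h)
    rcases hij with h | h
    · rw [hG.supp i j (Or.inl (by omega)), hG.supp i m (Or.inl (by omega))]; simp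
    · rw [hG.supp i j (Or.inr (by omega)), hG.supp m j (Or.inr (by omega))]; simp
  pos := by
    rintro x ⟨i, hi, hx⟩
    have hη := N.one_lt_η hC
    have hη' : (N.η m)⁻¹ ≤ 1 := inv_le_one_of_one_le₀ hη.le
    obtain ⟨t, ht⟩ := exists_qform_reduce_eq hC hG x
    have him : i ≠ m := fun h => by subst h; omega
    have h1 : 0 < qform (Function.update x m 0) G :=
      hG.pos _ ⟨i, by omega, by simpa [him] using hx⟩
    rw [ht]
    have h2 := mul_nonneg (sub_nonneg.2 hη') (hG.qform_nonneg (Function.update x m t))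
    have h3 : 0 < (N.η m)⁻¹ * qform (Function.update x m 0) G := by positivity
    linarith

theorem lambdaOf_smul (c : ℂ) (hc : c ≠ 0) :
    N.lambdaOf m (c • G) = c • N.lambdaOf m G := by
  ext i j
  simp only [lambdaOf, of_apply, Matrix.smul_apply, smul_eq_mul, mul_zero, mul_ite]
  split_ifs
  · rfl
  · ring
  · ring
  · have : c * G i m * (c * G m j) / (c * G m m) = c * (G i m * G m j / G m m) := by
      rw [show c * G i m * (c * G m j) = c * (c * (G i m * G m j)) by ring,
        mul_div_mul_left _ _ hc, mul_div_assoc]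
    rw [this]; ring

theorem reduce_smul (c : ℂ) (hc : c ≠ 0) : N.reduce m (c • G) = c • N.reduce m G := by
  have h : tailBlock m (c • N.lambdaOf m G) = c • tailBlock m (N.lambdaOf m G) := by
    ext i j; simp [tailBlock]
  rw [reduce, lambdaOf_smul c hc, h, reduce, smul_sub, smul_sub, smul_comm c, Matrix.smul_apply,
    smul_assoc]

theorem TailPosDef.smul {n : ℕ} (hG : TailPosDef n G) {c : ℝ} (hc : 0 < c) :
    TailPosDef n ((c : ℂ) • G) where
  herm := isHermitian_smul_ofReal hG.herm c
  supp i j h := by simp [hG.supp i j h]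
  pos x hx := by rw [qform_smul]; exact mul_pos hc (hG.pos x hx)

/-- `Λ_m` is the rank-one matrix of its `m`-th column, suitably normalized. -/
theorem lambdaOf_eq (hC : 0 < N.C m) (hG : TailPosDef (m : ℕ) G) :
    N.lambdaOf m G = outer fun i =>
      N.lambdaOf m G i m / (Real.sqrt (N.lambdaOf m G m m).re : ℂ) := by
  have h0 := N.one_lt_η hC
  have h1 : (N.η m : ℂ) ≠ 0 := by exact_mod_cast (by linarith : N.η m ≠ 0)
  have h2 : (N.η m : ℂ) - 1 ≠ 0 := by exact_mod_cast (by linarith : N.η m - 1 ≠ 0)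
  have hg : ((G m m).re : ℂ) ≠ 0 := by exact_mod_cast hG.diag_pos.ne'
  have hl : 0 < (N.lambdaOf m G m m).re := by
    rw [lambdaOf_diag_re]; exact div_pos hG.diag_pos (by linarith)
  have hsq : (Real.sqrt (N.lambdaOf m G m m).re : ℂ) * (Real.sqrt (N.lambdaOf m G m m).re : ℂ)
      = ((G m m).re : ℂ) / ((N.η m : ℂ) - 1) := by
    rw [← Complex.ofReal_mul, Real.mul_self_sqrt hl.le, lambdaOf_diag_re]
    push_cast; rfl
  ext i j
  have hout : outer (fun i => N.lambdaOf m G i m / (Real.sqrt (N.lambdaOf m G m m).re : ℂ)) i j =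
      N.lambdaOf m G i m * star (N.lambdaOf m G j m) /
        (((G m m).re : ℂ) / ((N.η m : ℂ) - 1)) := by
    rw [← hsq, outer, vecMulVec_apply, Pi.star_apply, star_div₀,
      show star (Real.sqrt (N.lambdaOf m G m m).re : ℂ) = _ from Complex.conj_ofReal _,
      div_mul_div_comm]
  rw [hout]
  have hst : ∀ r : ℝ, star (r : ℂ) = r := fun r => Complex.conj_ofReal r
  have hst1 : star ((N.η m : ℂ) - 1) = (N.η m : ℂ) - 1 := by rw [star_sub, hst, star_one]
  rcases lt_trichotomy i m with hi | rfl | hi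
  · simp [lambdaOf, hi]
  · rcases lt_trichotomy j i with hj | rfl | hj
    · simp [lambdaOf, hj]
    · rw [lambdaOf_diag, hG.diag_eq, Complex.ofReal_re, star_div₀, hst, hst1]
      field_simp
    · rw [lambdaOf_diag, hG.diag_eq, Complex.ofReal_re]
      simp only [lambdaOf, of_apply, hj.ne', hj.not_gt, lt_irrefl, or_self, if_false, and_false,
        or_true, true_or, if_true, star_div₀, hst, hG.herm.apply, and_true]
      field_simp
  · rcases lt_trichotomy j m with hj | rfl | hj
    · simp [lambdaOf, hj]
    · rw [lambdaOf_diag, hG.diag_eq, Complex.ofReal_re, star_div₀, hst, hst1]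
      field_simp
    · simp only [lambdaOf, of_apply, hi.ne', hi.not_gt, hj.ne', hj.not_gt, lt_irrefl, or_self,
        if_false, and_false, or_true, if_true, star_div₀, hst, hG.herm.apply, and_true]
      rw [hG.diag_eq m, Complex.ofReal_re]
      field_simp

end Step

/-! ### The dual recursion -/

section Dual

variable {N} {β β' : Fin K → ℝ}

theorem qform_Γ (β : Fin K → ℝ) (x : Fin M → ℂ) :
    qform x (N.Γ β) = ∑ i, ‖x i‖ ^ 2 + ∑ k, β k * ‖star x ⬝ᵥ N.h k‖ ^ 2 := by
  rw [Γ, qform_add, qform_one, qform_sum]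
  simp only [qform_smul, qform_outer]

theorem isHermitian_sum {ι : Type*} (s : Finset ι) {A : ι → Matrix (Fin M) (Fin M) ℂ}
    (h : ∀ i ∈ s, (A i).IsHermitian) : (∑ i ∈ s, A i).IsHermitian := by
  rw [IsHermitian, conjTranspose_sum]
  exact Finset.sum_congr rfl fun i hi => h i hi

theorem tailPosDef_Γ (hβ : 0 ≤ β) : TailPosDef 0 (N.Γ β) where
  herm := isHermitian_one.add (isHermitian_sum _ fun k _ =>
    isHermitian_smul_ofReal (isHermitian_outer _) _)
  supp i j h := by simp at h
  pos := by
    rintro x ⟨i, -, hi⟩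
    have hx : x ≠ 0 := fun h => hi (by simp [h])
    rw [qform_Γ]
    have h1 := sum_norm_sq_pos hx
    have h2 : 0 ≤ ∑ k, β k * ‖star x ⬝ᵥ N.h k‖ ^ 2 :=
      Finset.sum_nonneg fun k _ => mul_nonneg (hβ k) (by positivity)
    linarith

theorem tailPosDef_gammaSeq (hC : ∀ m, 0 < N.C m) (hβ : 0 ≤ β) :
    ∀ n ≤ M, TailPosDef n (N.gammaSeq β n)
  | 0, _ => tailPosDef_Γ hβ
  | n + 1, hn => by
    rw [gammaSeq_succ N β hn]
    exact TailPosDef.reduce (m := ⟨n, hn⟩) (hC _) (tailPosDef_gammaSeq hC hβ n (by omega))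

theorem qform_gammaSeq_mono (hC : ∀ m, 0 < N.C m) (hβ : 0 ≤ β) (hββ' : β ≤ β') :
    ∀ n ≤ M, ∀ x, qform x (N.gammaSeq β n) ≤ qform x (N.gammaSeq β' n)
  | 0, _, x => by
    simp only [gammaSeq, qform_Γ]
    gcongr with k
    exact hββ' k
  | n + 1, hn, x => by
    rw [gammaSeq_succ N β hn, gammaSeq_succ N β' hn]
    exact qform_reduce_mono (m := ⟨n, hn⟩) (hC _) (tailPosDef_gammaSeq hC hβ n (by omega))
      (tailPosDef_gammaSeq hC (hβ.trans hββ') n (by omega))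
      (qform_gammaSeq_mono hC hβ hββ' n (by omega)) x

/-- The recursion is subhomogeneous, because `Γ(αβ) ≤ α Γ(β)` and every step is monotone and
homogeneous. -/
theorem qform_gammaSeq_smul_le (hC : ∀ m, 0 < N.C m) (hβ : 0 ≤ β) {α : ℝ} (hα : 1 < α) :
    ∀ n ≤ M, ∀ x, qform x (N.gammaSeq (α • β) n) ≤ qform x ((α : ℂ) • N.gammaSeq β n)
  | 0, _, x => by
    simp only [gammaSeq, qform_smul, qform_Γ, mul_add, Finset.mul_sum]
    refine add_le_add (Finset.sum_le_sum fun i _ => ?_) (le_of_eq ?_)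
    · nlinarith [sq_nonneg ‖x i‖]
    · exact Finset.sum_congr rfl fun k _ => by simp [mul_assoc]
  | n + 1, hn, x => by
    have hα0 : (α : ℂ) ≠ 0 := by exact_mod_cast (by linarith : α ≠ 0)
    have hαβ : 0 ≤ α • β := fun k => mul_nonneg (by linarith) (hβ k)
    rw [gammaSeq_succ N β hn, gammaSeq_succ N (α • β) hn, ← reduce_smul _ hα0]
    exact qform_reduce_mono (m := ⟨n, hn⟩) (hC _) (tailPosDef_gammaSeq hC hαβ n (by omega))
      ((tailPosDef_gammaSeq hC hβ n (by omega)).smul (by linarith))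
      (qform_gammaSeq_smul_le hC hβ hα n (by omega)) x

/-- The elimination exhausts the right-hand side. -/
theorem D_Λof_eq_zero (hC : ∀ m, 0 < N.C m) (hβ : 0 ≤ β) : N.D β (N.Λof β) = 0 := by
  set g : ℕ → Matrix (Fin M) (Fin M) ℂ := fun n =>
    if hn : n < M then (N.η ⟨n, hn⟩ : ℂ) • tailBlock ⟨n, hn⟩ (N.Λof β ⟨n, hn⟩) -
      N.Λof β ⟨n, hn⟩ ⟨n, hn⟩ ⟨n, hn⟩ • E ⟨n, hn⟩ else 0 with hg
  have hseq : ∀ n ≤ M, N.gammaSeq β n = N.Γ β - ∑ i ∈ Finset.range n, g i := by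
    intro n
    induction n with
    | zero => intro _; simp [gammaSeq]
    | succ n ih =>
      intro hn
      rw [gammaSeq_succ N β hn, reduce, Finset.sum_range_succ, ← sub_sub, ← ih (by omega)]
      simp only [hg, dif_pos (show n < M from hn), Λof]
  have hM : N.gammaSeq β M = 0 := by
    ext i j
    exact (tailPosDef_gammaSeq hC hβ M le_rfl).supp i j (Or.inl i.2)
  have hsum : ∑ i ∈ Finset.range M, g i =
      ∑ m, ((N.η m : ℂ) • tailBlock m (N.Λof β m) - N.Λof β m m m • E m) := by
    rw [Finset.sum_range]
    refine Finset.sum_congr rfl fun m _ => ?_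
    simp [hg]
  rw [hseq M le_rfl, hsum, Finset.sum_sub_distrib] at hM
  rw [D, ← hM]
  abel

theorem Λof_diag_re_pos (hC : ∀ m, 0 < N.C m) (hβ : 0 ≤ β) (m : Fin M) :
    0 < (N.Λof β m m m).re := by
  rw [Λof, lambdaOf_diag_re]
  exact div_pos (tailPosDef_gammaSeq hC hβ m m.2.le).diag_pos
    (by linarith [N.one_lt_η (hC m)])

theorem Λof_eq_outer (hC : ∀ m, 0 < N.C m) (hβ : 0 ≤ β) (m : Fin M) :
    N.Λof β m = outer (N.lam β m) :=
  lambdaOf_eq (hC m) (tailPosDef_gammaSeq hC hβ m m.2.le)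

theorem Λof_diag_ofReal (hC : ∀ m, 0 < N.C m) (hβ : 0 ≤ β) (m : Fin M) :
    N.Λof β m m m = ((N.Λof β m m m).re : ℂ) := by
  rw [Λof_eq_outer hC hβ]
  exact ((isHermitian_outer _).coe_re_apply_self m).symm

theorem Λof_diag_mono (hC : ∀ m, 0 < N.C m) (hβ : 0 ≤ β) (hββ' : β ≤ β') (m : Fin M) :
    (N.Λof β m m m).re ≤ (N.Λof β' m m m).re := by
  rw [Λof, Λof, lambdaOf_diag_re, lambdaOf_diag_re, ← qform_single, ← qform_single]
  have := N.one_lt_η (hC m)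
  exact div_le_div_of_nonneg_right (qform_gammaSeq_mono hC hβ hββ' m m.2.le _) (by linarith)

theorem Λof_diag_smul_le (hC : ∀ m, 0 < N.C m) (hβ : 0 ≤ β) {α : ℝ} (hα : 1 < α)
    (m : Fin M) : (N.Λof (α • β) m m m).re ≤ α * (N.Λof β m m m).re := by
  rw [Λof, Λof, lambdaOf_diag_re, lambdaOf_diag_re, ← qform_single, ← qform_single,
    ← mul_div_assoc, ← qform_smul]
  have := N.one_lt_η (hC m)
  exact div_le_div_of_nonneg_right (qform_gammaSeq_smul_le hC hβ hα m m.2.le _) (by linarith)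

/-! ### The dual fixed point map -/

theorem qform_Cmat (β : Fin K → ℝ) (Λ : Fin M → Matrix (Fin M) (Fin M) ℂ) (k : Fin K)
    (x : Fin M → ℂ) :
    qform x (N.Cmat β Λ k) = ∑ i, ‖x i‖ ^ 2 +
      ∑ j ∈ Finset.univ.erase k, β j * ‖star x ⬝ᵥ N.h j‖ ^ 2 +
      ∑ m, (Λ m m m).re * ‖x m‖ ^ 2 := by
  rw [Cmat, qform_add, qform_add, qform_one, qform_sum, qform_sum]
  simp only [qform_smul, qform_outer, qform_smul_E]

theorem isHermitian_E (m : Fin M) : (E m).IsHermitian := by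
  rw [E, IsHermitian, conjTranspose_single, star_one]

theorem isHermitian_Cmat (hC : ∀ m, 0 < N.C m) (hβ : 0 ≤ β) (k : Fin K) :
    (N.Cmat β (N.Λof β) k).IsHermitian := by
  refine (isHermitian_one.add (isHermitian_sum _ fun k _ =>
    isHermitian_smul_ofReal (isHermitian_outer _) _)).add (isHermitian_sum _ fun m _ => ?_)
  rw [Λof_diag_ofReal hC hβ]
  exact isHermitian_smul_ofReal (isHermitian_E m) _

theorem posDef_Cmat (hC : ∀ m, 0 < N.C m) (hβ : 0 ≤ β) (k : Fin K) :
    (N.Cmat β (N.Λof β) k).PosDef := by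
  refine posDef_of_qform (isHermitian_Cmat hC hβ k) fun x hx => ?_
  rw [qform_Cmat]
  have h1 := sum_norm_sq_pos hx
  have h2 : 0 ≤ ∑ j ∈ Finset.univ.erase k, β j * ‖star x ⬝ᵥ N.h j‖ ^ 2 :=
    Finset.sum_nonneg fun j _ => mul_nonneg (hβ j) (by positivity)
  have h3 : 0 ≤ ∑ m, (N.Λof β m m m).re * ‖x m‖ ^ 2 :=
    Finset.sum_nonneg fun m _ => mul_nonneg (Λof_diag_re_pos hC hβ m).le (by positivity)
  linarith

theorem inv_mulVec_ne_zero (hC : ∀ m, 0 < N.C m) (hh : ∀ k, N.h k ≠ 0) (hβ : 0 ≤ β)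
    (k : Fin K) : (N.Cmat β (N.Λof β) k)⁻¹ *ᵥ N.h k ≠ 0 := fun h0 => by
  have := mul_inv_mulVec (posDef_Cmat hC hβ k) (N.h k)
  rw [h0, mulVec_zero] at this
  exact hh k this.symm

/-- The dual fixed point map is a standard interference function. -/
theorem isStandardInterference_dualMap (hC : ∀ m, 0 < N.C m) (hγ : ∀ k, 0 < N.γ k)
    (hh : ∀ k, N.h k ≠ 0) : IsStandardInterference N.dualMap where
  pos β hβ k := div_pos (hγ k) (qform_inv_pos (posDef_Cmat hC hβ k) (hh k))
  mono β β' hβ hββ' k := by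
    have hβ' := hβ.trans hββ'
    refine div_le_div_of_nonneg_left (hγ k).le (qform_inv_pos (posDef_Cmat hC hβ' k) (hh k)) ?_
    refine qform_inv_le (posDef_Cmat hC hβ k) (posDef_Cmat hC hβ' k) ?_
    rw [qform_Cmat, qform_Cmat]
    refine add_le_add (add_le_add_right (Finset.sum_le_sum fun j _ => ?_) _)
      (Finset.sum_le_sum fun m _ => ?_)
    · exact mul_le_mul_of_nonneg_right (hββ' j) (by positivity)
    · exact mul_le_mul_of_nonneg_right (Λof_diag_mono hC hβ hββ' m) (by positivity)
  scale β hβ α hα k := by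
    have hα0 : 0 < α := by linarith
    have hαβ : 0 ≤ α • β := fun k => mul_nonneg hα0.le (hβ k)
    have hA := posDef_Cmat hC hαβ k
    have hB := posDef_Cmat hC hβ k
    have hA' := qform_inv_pos hA (hh k)
    have hB' := qform_inv_pos hB (hh k)
    set C := N.Cmat β (N.Λof β) k with hCdef
    have hαB : ((α : ℂ) • C).PosDef := hB.smul (by exact_mod_cast hα0)
    have hinv : ((α : ℂ) • C)⁻¹ = ((α⁻¹ : ℝ) : ℂ) • C⁻¹ := by
      have hα0' : (α : ℂ) ≠ 0 := by exact_mod_cast hα0.ne'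
      refine Matrix.inv_eq_left_inv ?_
      rw [smul_mul_smul_comm, nonsing_inv_mul _ ((isUnit_iff_isUnit_det C).1 hB.isUnit),
        Complex.ofReal_inv, inv_mul_cancel₀ hα0', one_smul]
    have hlt := qform_inv_lt hA hαB (hh k) ?_
    · rw [hinv, qform_smul] at hlt
      change N.γ k / _ < α * (N.γ k / _)
      rw [div_lt_iff₀ hA']
      have h1 := mul_lt_mul_of_pos_left hlt
        (mul_pos hα0 (div_pos (hγ k) hB'))
      have h2 : α * (N.γ k / qform (N.h k) C⁻¹) * (α⁻¹ * qform (N.h k) C⁻¹) = N.γ k := by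
        field_simp
      rwa [h2] at h1
    · -- `C_k(αβ) ≤ α C_k(β) - (α - 1) I`
      have hx : ((α : ℂ) • C)⁻¹ *ᵥ N.h k ≠ 0 := fun h0 => by
        have := mul_inv_mulVec hαB (N.h k)
        rw [h0, mulVec_zero] at this
        exact hh k this.symm
      generalize ((α : ℂ) • C)⁻¹ *ᵥ N.h k = x at hx
      rw [qform_smul, hCdef, qform_Cmat, qform_Cmat, mul_add, mul_add,
        Finset.mul_sum (Finset.univ.erase k) _ α, Finset.mul_sum _ (fun m => _ * ‖x m‖ ^ 2) α]
      have h1 := sum_norm_sq_pos hx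
      have h2 : ∑ i, ‖x i‖ ^ 2 < α * ∑ i, ‖x i‖ ^ 2 := by nlinarith
      refine add_lt_add_of_lt_of_le (add_lt_add_of_lt_of_le h2 (le_of_eq ?_))
        (Finset.sum_le_sum fun m _ => ?_)
      · exact Finset.sum_congr rfl fun j _ => by simp [mul_assoc]
      · rw [← mul_assoc]
        exact mul_le_mul_of_nonneg_right (Λof_diag_smul_le hC hβ hα m) (by positivity)

/-- A point below its image under the dual map is feasible for the dual problem. -/
theorem posSemidef_slackMat (hC : ∀ m, 0 < N.C m) (hγ : ∀ k, 0 < N.γ k)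
    (hh : ∀ k, N.h k ≠ 0) (hβ : 0 ≤ β) (hle : β ≤ N.dualMap β) (k : Fin K) :
    (N.slackMat β (N.Λof β) k).PosSemidef := by
  refine posSemidef_of_qform ((isHermitian_Cmat hC hβ k).sub
    (isHermitian_smul_ofReal (isHermitian_outer _) _)) fun x => ?_
  rw [slackMat, qform_sub, qform_smul, qform_outer, star_dotProduct_comm, norm_star]
  have hP := posDef_Cmat hC hβ k
  have h1 := norm_sq_dotProduct_le hP (N.h k) x
  have h2 := hle k
  have h3 := qform_inv_pos hP (hh k)
  rw [dualMap, le_div_iff₀ h3] at h2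
  have h4 : β k / N.γ k * qform (N.h k) (N.Cmat β (N.Λof β) k)⁻¹ ≤ 1 := by
    rw [div_mul_eq_mul_div, div_le_one (hγ k)]
    exact h2
  have h5 := qform_nonneg hP.posSemidef x
  have h6 := mul_le_mul_of_nonneg_left h1 (div_nonneg (hβ k) (hγ k).le)
  nlinarith

/-- At a fixed point of the dual map, `C_k⁻¹ h_k` spans the kernel of the slack matrix. -/
theorem slackMat_mulVec (hC : ∀ m, 0 < N.C m) (hγ : ∀ k, 0 < N.γ k) (hh : ∀ k, N.h k ≠ 0)
    (hβ : 0 ≤ β) (hfix : N.dualMap β = β) (k : Fin K) :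
    N.slackMat β (N.Λof β) k *ᵥ ((N.Cmat β (N.Λof β) k)⁻¹ *ᵥ N.h k) = 0 := by
  have hP := posDef_Cmat hC hβ k
  have h3 := (qform_inv_pos hP (hh k)).ne'
  have h4 : β k / N.γ k * qform (N.h k) (N.Cmat β (N.Λof β) k)⁻¹ = 1 := by
    have : β k = N.γ k / qform (N.h k) (N.Cmat β (N.Λof β) k)⁻¹ :=
      (congrFun hfix k).symm
    rw [this]
    have := (hγ k).ne'
    field_simp
  rw [slackMat, sub_mulVec, mul_inv_mulVec hP, smul_mulVec, outer, vecMulVec_mulVec,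
    qform_inv_ofReal hP, sub_eq_zero]
  ext i
  have h5 : ((β k / N.γ k : ℝ) : ℂ) * (qform (N.h k) (N.Cmat β (N.Λof β) k)⁻¹ : ℂ) = 1 := by
    exact_mod_cast h4
  simp only [Pi.smul_apply, MulOpposite.smul_eq_mul_unop, MulOpposite.unop_op, smul_eq_mul]
  rw [mul_left_comm, h5, mul_one]

theorem rank_add_le_add (A B : Matrix (Fin M) (Fin M) ℂ) : (A + B).rank ≤ A.rank + B.rank := by
  rw [Matrix.rank, Matrix.rank, Matrix.rank, mulVecLin_add]
  exact (Submodule.finrank_mono (LinearMap.range_add_le _ _)).trans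
    (Submodule.finrank_add_le_finrank_add_finrank _ _)

theorem rank_slackMat (hC : ∀ m, 0 < N.C m) (hγ : ∀ k, 0 < N.γ k) (hh : ∀ k, N.h k ≠ 0)
    (hβ : 0 ≤ β) (hfix : N.dualMap β = β) (k : Fin K) :
    (N.slackMat β (N.Λof β) k).rank + 1 = M := by
  have hP := posDef_Cmat hC hβ k
  have hker := slackMat_mulVec hC hγ hh hβ hfix k
  have hne := inv_mulVec_ne_zero hC hh hβ k
  refine le_antisymm ?_ ?_
  · have h1 := (N.slackMat β (N.Λof β) k).mulVecLin.finrank_range_add_finrank_ker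
    rw [Module.finrank_fin_fun] at h1
    have h2 : 0 < Module.finrank ℂ (LinearMap.ker (N.slackMat β (N.Λof β) k).mulVecLin) := by
      rw [Module.finrank_pos_iff_exists_ne_zero]
      exact ⟨⟨_, hker⟩, fun h => hne (congrArg Subtype.val h)⟩
    rw [Matrix.rank]
    omega
  · have h1 : N.Cmat β (N.Λof β) k = N.slackMat β (N.Λof β) k +
        ((β k / N.γ k : ℝ) : ℂ) • outer (N.h k) := by rw [slackMat]; abel
    have h2 := rank_of_isUnit _ hP.isUnit
    rw [h1, Fintype.card_fin] at h2
    have h3 := rank_add_le_add (N.slackMat β (N.Λof β) k)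
      (((β k / N.γ k : ℝ) : ℂ) • outer (N.h k))
    have h4 : (((β k / N.γ k : ℝ) : ℂ) • outer (N.h k)).rank ≤ 1 := by
      rw [outer, ← smul_vecMulVec]
      exact rank_vecMulVec_le _ _
    omega

end Dual

/-! ### The back substitution for the compression covariance -/

section Primal

variable {N} {β p : Fin K → ℝ} {m : Fin M} {q : Matrix (Fin M) (Fin M) ℂ}

theorem Vhat_diag (β : Fin K → ℝ) (k : Fin K) (m : Fin M) :
    N.Vhat β k m m = ((‖N.direction β k m‖ ^ 2 : ℝ) : ℂ) := by
  simp [Vhat, outer, vecMulVec_apply, Complex.mul_conj']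

theorem lam_diag_ne_zero (hC : ∀ m, 0 < N.C m) (hβ : 0 ≤ β) (m : Fin M) :
    N.lam β m m ≠ 0 := by
  have h := Λof_diag_re_pos hC hβ m
  have h1 : N.Λof β m m m ≠ 0 := fun h0 => by rw [h0] at h; simp at h
  exact div_ne_zero h1 (by exact_mod_cast (Real.sqrt_pos.2 h).ne')

theorem mulVec_apply_eq_zero {i : Fin M} (hq : ∀ j, q i j = 0) (x : Fin M → ℂ) :
    (q *ᵥ x) i = 0 := by
  rw [mulVec, dotProduct]
  exact Finset.sum_eq_zero fun s _ => by rw [hq s, zero_mul]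

/-- Since `q` vanishes outside the block of indices larger than `m`, the sums in the back
substitution may be taken over all indices. -/
theorem sum_Ioi_eq (hq : ∀ i j : Fin M, i ≤ m ∨ j ≤ m → q i j = 0) (x : Fin M → ℂ) (i : Fin M) :
    ∑ s ∈ Finset.Ioi m, q i s * x s = (q *ᵥ x) i := by
  refine Finset.sum_subset (Finset.subset_univ _) fun s _ hs => ?_
  rw [hq i s (Or.inr (by simpa using hs)), zero_mul]

theorem fillQ_diag (hq : ∀ i j : Fin M, i ≤ m ∨ j ≤ m → q i j = 0) :
    N.fillQ β p m q m m = (N.η m : ℂ) / ((N.η m : ℂ) - 1) *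
        ((star (N.lam β m) ⬝ᵥ (q *ᵥ N.lam β m)) / ((‖N.lam β m m‖ ^ 2 : ℝ) : ℂ))
      + 1 / ((N.η m : ℂ) - 1) * ∑ k, (p k : ℂ) * N.Vhat β k m m := by
  have h : ∑ r ∈ Finset.Ioi m, ∑ s ∈ Finset.Ioi m, star (N.lam β m r) * q r s * N.lam β m s =
      star (N.lam β m) ⬝ᵥ (q *ᵥ N.lam β m) := by
    simp only [mul_assoc, ← Finset.mul_sum, sum_Ioi_eq hq]
    refine Finset.sum_subset (Finset.subset_univ _) fun r _ hr => ?_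
    have : (q *ᵥ N.lam β m) r = 0 := mulVec_apply_eq_zero (fun s => hq r s (Or.inl (by simpa using hr))) _
    rw [this, mul_zero]
  simp only [fillQ, of_apply, and_self, if_true, h]

theorem fillQ_left (hq : ∀ i j : Fin M, i ≤ m ∨ j ≤ m → q i j = 0) {i : Fin M} (hi : i ≠ m) :
    N.fillQ β p m q i m = -(q *ᵥ N.lam β m) i / N.lam β m m := by
  rcases lt_or_gt_of_ne hi with h | h
  · have : (q *ᵥ N.lam β m) i = 0 := mulVec_apply_eq_zero (fun s => hq i s (Or.inl h.le)) _
    simp [fillQ, h.ne, h.not_gt, hq i m (Or.inl h.le), this]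
  · simp only [fillQ, of_apply, hi, false_and, if_false, h, and_self, if_true, sum_Ioi_eq hq]

theorem fillQ_right (hq : ∀ i j : Fin M, i ≤ m ∨ j ≤ m → q i j = 0) {j : Fin M} (hj : j ≠ m) :
    N.fillQ β p m q m j = star (-(q *ᵥ N.lam β m) j / N.lam β m m) := by
  rcases lt_or_gt_of_ne hj with h | h
  · have : (q *ᵥ N.lam β m) j = 0 := mulVec_apply_eq_zero (fun s => hq j s (Or.inl h.le)) _
    simp [fillQ, h.ne, h.not_gt, hq m j (Or.inr h.le), this]
  · simp only [fillQ, of_apply, hj, and_false, false_and, if_false, h, and_self, if_true,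
      sum_Ioi_eq hq]

theorem fillQ_of_ne {i j : Fin M} (hi : i ≠ m) (hj : j ≠ m) :
    N.fillQ β p m q i j = q i j := by
  simp [fillQ, hi, hj]

/-- The elimination matrix `1 - λ_m e_m† / λ_m^(m)`; its kernel is spanned by `λ_m`. -/
noncomputable def elimMat (N : RelayNetwork M K) (β : Fin K → ℝ) (m : Fin M) :
    Matrix (Fin M) (Fin M) ℂ :=
  1 - vecMulVec (N.lam β m) (Pi.single m (N.lam β m m)⁻¹)

theorem elimMat_mulVec_lam (hl : N.lam β m m ≠ 0) : N.elimMat β m *ᵥ N.lam β m = 0 := by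
  rw [elimMat, sub_mulVec, one_mulVec, vecMulVec_mulVec, single_dotProduct, inv_mul_cancel₀ hl]
  simp

theorem conj_elimMat (hq : q.IsHermitian) :
    (N.elimMat β m)ᴴ * q * N.elimMat β m =
      q - vecMulVec (q *ᵥ N.lam β m) (Pi.single m (N.lam β m m)⁻¹)
        - vecMulVec (star (Pi.single m (N.lam β m m)⁻¹)) (star (q *ᵥ N.lam β m))
        + (star (N.lam β m) ⬝ᵥ (q *ᵥ N.lam β m)) •
          vecMulVec (star (Pi.single m (N.lam β m m)⁻¹)) (Pi.single m (N.lam β m m)⁻¹) := by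
  rw [elimMat, conjTranspose_sub, conjTranspose_one, conjTranspose_vecMulVec, Matrix.sub_mul,
    Matrix.one_mul, Matrix.mul_sub, Matrix.mul_one, Matrix.sub_mul, mul_vecMulVec, vecMulVec_mul,
    star_mulVec, hq.eq, vecMulVec_mul_vecMulVec, ← dotProduct_mulVec, vecMulVec_smul]
  abel

/-- The defining equations of the back substitution: the `m`-th fronthaul constraint matrix is
congruent to `η_m q` through the elimination matrix. -/
theorem smul_fillQ_sub (hC : 0 < N.C m) (hl : N.lam β m m ≠ 0) (hH : q.IsHermitian)
    (hq : ∀ i j : Fin M, i ≤ m ∨ j ≤ m → q i j = 0) :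
    (N.η m : ℂ) • N.fillQ β p m q -
        (∑ k, (p k : ℂ) * N.Vhat β k m m + N.fillQ β p m q m m) • E m =
      (N.η m : ℂ) • ((N.elimMat β m)ᴴ * q * N.elimMat β m) := by
  have h0 := N.one_lt_η hC
  have h2 : (N.η m : ℂ) - 1 ≠ 0 := by exact_mod_cast (by linarith : N.η m - 1 ≠ 0)
  have hwm : (q *ᵥ N.lam β m) m = 0 := mulVec_apply_eq_zero (fun s => hq m s (Or.inl le_rfl)) _
  rw [conj_elimMat hH]
  ext i j
  by_cases hi : i = m
  · by_cases hj : j = m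
    · subst hi; subst hj
      have h3 : ((‖N.lam β j j‖ ^ 2 : ℝ) : ℂ) = star (N.lam β j j) * N.lam β j j := by
        simp [Complex.conj_mul']
      have h4 : star (N.lam β j j) ≠ 0 := star_ne_zero.2 hl
      have h5 : (star (Pi.single j (N.lam β j j)⁻¹) : Fin M → ℂ) j = (star (N.lam β j j))⁻¹ := by
        simp
      have h6 := fillQ_diag (N := N) (β := β) (p := p) hq
      simp only [Matrix.sub_apply, Matrix.smul_apply, Matrix.add_apply, smul_eq_mul,
        vecMulVec_apply, hwm, h5, hq j j (Or.inl le_rfl), E, single_apply_same, Pi.single_eq_same,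
        Pi.star_apply, star_zero]
      rw [h6, h3]
      field_simp
      ring
    · subst hi
      have h5 : (star (Pi.single i (N.lam β i i)⁻¹) : Fin M → ℂ) i = (star (N.lam β i i))⁻¹ := by
        simp
      have h7 : (Pi.single i (N.lam β i i)⁻¹ : Fin M → ℂ) j = 0 := by simp [hj]
      have h8 : E i i j = 0 := by simp [E, Ne.symm hj]
      simp only [Matrix.sub_apply, Matrix.smul_apply, Matrix.add_apply, smul_eq_mul,
        vecMulVec_apply, h5, h7, h8, hq i j (Or.inl le_rfl), fillQ_right hq hj, Pi.star_apply,
        star_div₀, star_neg]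
      ring
  · have h7 : (Pi.single m (N.lam β m m)⁻¹ : Fin M → ℂ) i = 0 := by simp [hi]
    have h8 : E m i j = 0 := by simp [E, Ne.symm hi]
    by_cases hj : j = m
    · subst hj
      simp only [Matrix.sub_apply, Matrix.smul_apply, Matrix.add_apply, smul_eq_mul,
        vecMulVec_apply, h7, h8, hq i j (Or.inr le_rfl), fillQ_left hq hi, Pi.star_apply,
        star_zero, Pi.single_eq_same]
      ring
    · have h9 : (Pi.single m (N.lam β m m)⁻¹ : Fin M → ℂ) j = 0 := by simp [hj]
      simp only [Matrix.sub_apply, Matrix.smul_apply, Matrix.add_apply, smul_eq_mul,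
        vecMulVec_apply, h7, h8, h9, fillQ_of_ne hi hj, Pi.star_apply, star_zero]
      ring

theorem posSemidef_E (m : Fin M) : (E m).PosSemidef :=
  posSemidef_of_qform (isHermitian_E m) fun x => by
    have := qform_smul_E x 1 m
    rw [one_smul] at this
    rw [this, Complex.one_re, one_mul]; positivity

theorem posSemidef_fillQ (hC : 0 < N.C m) (hl : N.lam β m m ≠ 0) (hp : 0 ≤ p)
    (hP : q.PosSemidef) (hq : ∀ i j : Fin M, i ≤ m ∨ j ≤ m → q i j = 0) :
    (N.fillQ β p m q).PosSemidef := by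
  have h0 := N.one_lt_η hC
  have h1 : (N.η m : ℂ) ≠ 0 := by exact_mod_cast (by linarith : N.η m ≠ 0)
  have heq := smul_fillQ_sub (p := p) hC hl hP.isHermitian hq
  set s : ℝ := ∑ k, p k * ‖N.direction β k m‖ ^ 2 with hs
  have hs0 : 0 ≤ s := Finset.sum_nonneg fun k _ => mul_nonneg (hp k) (by positivity)
  have hsum : ∑ k, (p k : ℂ) * N.Vhat β k m m = (s : ℂ) := by
    simp only [Vhat_diag, hs]; push_cast; rfl
  set f : ℝ := N.η m / (N.η m - 1) * (qform (N.lam β m) q / ‖N.lam β m m‖ ^ 2) +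
    1 / (N.η m - 1) * s with hf
  have hdiag : N.fillQ β p m q m m = (f : ℂ) := by
    rw [fillQ_diag hq, hsum, dotProduct_mulVec_eq_qform hP.isHermitian, hf]
    push_cast; rfl
  have hf0 : 0 ≤ f := by
    have h2 : 0 ≤ N.η m - 1 := by linarith
    have h3 := qform_nonneg hP (N.lam β m)
    have h4 : 0 ≤ N.η m := by linarith
    positivity
  have hF : N.fillQ β p m q = (N.elimMat β m)ᴴ * q * N.elimMat β m +
      (((s + f) / N.η m : ℝ) : ℂ) • E m := by
    refine smul_right_injective _ h1 ?_
    simp only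
    rw [smul_add, ← heq, smul_smul, hsum, hdiag]
    have : (N.η m : ℂ) * (((s + f) / N.η m : ℝ) : ℂ) = (s : ℂ) + (f : ℂ) := by
      push_cast; field_simp
    rw [this]; abel
  rw [hF]
  refine (hP.conjTranspose_mul_mul_same _).add ((posSemidef_E m).smul ?_)
  have : 0 ≤ (s + f) / N.η m := div_nonneg (by linarith) (by linarith)
  exact_mod_cast this

theorem fillQ_linear (c : ℝ) (p p' : Fin K → ℝ) (q q' : Matrix (Fin M) (Fin M) ℂ) :
    N.fillQ β (c • p + p') m ((c : ℂ) • q + q') =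
      (c : ℂ) • N.fillQ β p m q + N.fillQ β p' m q' := by
  have hrow : ∀ i, ∑ s ∈ Finset.Ioi m, ((c : ℂ) • q + q') i s * N.lam β m s =
      c * ∑ s ∈ Finset.Ioi m, q i s * N.lam β m s + ∑ s ∈ Finset.Ioi m, q' i s * N.lam β m s := by
    intro i
    rw [Finset.mul_sum, ← Finset.sum_add_distrib]
    refine Finset.sum_congr rfl fun s _ => ?_
    simp only [Matrix.add_apply, Matrix.smul_apply, smul_eq_mul]; ring
  have hsum : ∑ k, (((c • p + p') k : ℝ) : ℂ) * N.Vhat β k m m =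
      c * ∑ k, (p k : ℂ) * N.Vhat β k m m + ∑ k, (p' k : ℂ) * N.Vhat β k m m := by
    rw [Finset.mul_sum, ← Finset.sum_add_distrib]
    refine Finset.sum_congr rfl fun s _ => ?_
    simp only [Pi.add_apply, Pi.smul_apply, smul_eq_mul]; push_cast; ring
  have hc : star (c : ℂ) = c := Complex.conj_ofReal c
  ext i j
  change _ = (c : ℂ) * N.fillQ β p m q i j + N.fillQ β p' m q' i j
  simp only [fillQ, of_apply, mul_assoc, ← Finset.mul_sum, hrow, hsum]
  split_ifs
  · simp only [mul_add, Finset.sum_add_distrib, mul_left_comm _ (c : ℂ), ← Finset.mul_sum]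
    ring
  · ring
  · simp only [star_div₀, star_neg, star_add, star_mul', hc]; ring
  · rfl

theorem qSeq_linear (c : ℝ) (p p' : Fin K → ℝ) (n : ℕ) :
    N.qSeq β (c • p + p') n = (c : ℂ) • N.qSeq β p n + N.qSeq β p' n := by
  induction n with
  | zero => simp [qSeq]
  | succ n ih =>
    simp only [qSeq, ih]
    split_ifs
    · exact fillQ_linear c p p' _ _
    · rfl

theorem Qof_linear (c : ℝ) (p p' : Fin K → ℝ) :
    N.Qof β (c • p + p') = (c : ℂ) • N.Qof β p + N.Qof β p' :=
  qSeq_linear c p p' M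

theorem qSeq_succ (β p : Fin K → ℝ) {n : ℕ} (hn : n < M) :
    N.qSeq β p (n + 1) = N.fillQ β p (Fin.rev ⟨n, hn⟩) (N.qSeq β p n) := by
  rw [qSeq, dif_pos hn]

theorem qSeq_apply_eq_zero (β p : Fin K → ℝ) (n : ℕ) (i j : Fin M)
    (h : (i : ℕ) + n < M ∨ (j : ℕ) + n < M) : N.qSeq β p n i j = 0 := by
  induction n with
  | zero => simp [qSeq]
  | succ n ih =>
    have hn : n < M := by omega
    have hmv : ((Fin.rev ⟨n, hn⟩ : Fin M) : ℕ) = M - (n + 1) := Fin.val_rev _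
    rw [qSeq_succ β p hn]
    generalize Fin.rev ⟨n, hn⟩ = m at hmv
    have h0 := ih (by omega)
    by_cases hi : i = m
    · have hj : j < m := by rw [Fin.lt_def]; subst hi; omega
      simp [fillQ, hj.ne, hj.not_gt, h0]
    by_cases hj : j = m
    · have hi' : i < m := by rw [Fin.lt_def]; subst hj; omega
      simp [fillQ, hi'.ne, hi'.not_gt, h0]
    rw [fillQ_of_ne hi hj, h0]

/-- The part of the matrix that is still zero before row `m` is filled in. -/
theorem qSeq_apply_eq_zero_of_le_rev (β p : Fin K → ℝ) {n : ℕ} (hn : n < M) (i j : Fin M)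
    (h : i ≤ Fin.rev ⟨n, hn⟩ ∨ j ≤ Fin.rev ⟨n, hn⟩) : N.qSeq β p n i j = 0 := by
  rw [Fin.le_def, Fin.le_def, Fin.val_rev] at h
  exact qSeq_apply_eq_zero β p n i j (by simp only at h; omega)

theorem posSemidef_qSeq (hC : ∀ m, 0 < N.C m) (hβ : 0 ≤ β) (hp : 0 ≤ p) :
    ∀ n ≤ M, (N.qSeq β p n).PosSemidef
  | 0, _ => PosSemidef.zero
  | n + 1, hn => by
    rw [qSeq_succ β p hn]
    exact posSemidef_fillQ (hC _) (lam_diag_ne_zero hC hβ _) hp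
      (posSemidef_qSeq hC hβ hp n (by omega)) (qSeq_apply_eq_zero_of_le_rev β p hn)

theorem posSemidef_Qof (hC : ∀ m, 0 < N.C m) (hβ : 0 ≤ β) (hp : 0 ≤ p) :
    (N.Qof β p).PosSemidef := posSemidef_qSeq hC hβ hp M le_rfl

/-- Entries that have been filled in do not change any more. -/
theorem qSeq_apply_eq_of_le (β p : Fin K → ℝ) {n n' : ℕ} (hnn' : n ≤ n') (hn' : n' ≤ M)
    {i j : Fin M} (hi : M ≤ (i : ℕ) + n) (hj : M ≤ (j : ℕ) + n) :
    N.qSeq β p n' i j = N.qSeq β p n i j := by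
  induction n', hnn' using Nat.le_induction with
  | base => rfl
  | succ k hk ih =>
    have hkM : k < M := by omega
    have hmv : ((Fin.rev ⟨k, hkM⟩ : Fin M) : ℕ) = M - (k + 1) := Fin.val_rev _
    rw [qSeq_succ β p hkM, fillQ_of_ne, ih (by omega)]
    · intro h; rw [h] at hi; omega
    · intro h; rw [h] at hj; omega

theorem tailBlock_Qof (β p : Fin K → ℝ) {n : ℕ} (hn : n < M) :
    tailBlock (Fin.rev ⟨n, hn⟩) (N.Qof β p) = N.qSeq β p (n + 1) := by
  have hmv : ((Fin.rev ⟨n, hn⟩ : Fin M) : ℕ) = M - (n + 1) := Fin.val_rev _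
  ext i j
  simp only [tailBlock, of_apply, Fin.le_def, hmv]
  split_ifs with h
  · exact qSeq_apply_eq_of_le β p hn le_rfl (by omega) (by omega)
  · exact (qSeq_apply_eq_zero β p (n + 1) i j (by omega)).symm

/-- The fronthaul constraint matrix of the recovered primal point. -/
theorem B_Vof_Qof (hC : ∀ m, 0 < N.C m) (hβ : 0 ≤ β) (hp : 0 ≤ p) {n : ℕ} (hn : n < M) :
    N.B (N.Vof β p) (N.Qof β p) (Fin.rev ⟨n, hn⟩) =
      (N.η (Fin.rev ⟨n, hn⟩) : ℂ) • ((N.elimMat β (Fin.rev ⟨n, hn⟩))ᴴ * N.qSeq β p n *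
        N.elimMat β (Fin.rev ⟨n, hn⟩)) := by
  have hdiag : N.Qof β p (Fin.rev ⟨n, hn⟩) (Fin.rev ⟨n, hn⟩) =
      N.qSeq β p (n + 1) (Fin.rev ⟨n, hn⟩) (Fin.rev ⟨n, hn⟩) := by
    rw [← tailBlock_Qof β p hn]; simp [tailBlock]
  rw [B, tailBlock_Qof, hdiag, qSeq_succ β p hn,
    ← smul_fillQ_sub (p := p) (hC _) (lam_diag_ne_zero hC hβ _)
      (posSemidef_qSeq hC hβ hp n hn.le).isHermitian (qSeq_apply_eq_zero_of_le_rev β p hn)]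
  rfl

theorem posSemidef_B (hC : ∀ m, 0 < N.C m) (hβ : 0 ≤ β) (hp : 0 ≤ p) (m : Fin M) :
    (N.B (N.Vof β p) (N.Qof β p) m).PosSemidef := by
  obtain ⟨⟨n, hn⟩, rfl⟩ := Fin.rev_surjective m
  rw [B_Vof_Qof hC hβ hp]
  have : 0 ≤ N.η (Fin.rev ⟨n, hn⟩) := by linarith [N.one_lt_η (hC (Fin.rev ⟨n, hn⟩))]
  exact ((posSemidef_qSeq hC hβ hp n hn.le).conjTranspose_mul_mul_same _).smul
    (by exact_mod_cast this)

theorem trace_Λof_mul_B (hC : ∀ m, 0 < N.C m) (hβ : 0 ≤ β) (hp : 0 ≤ p) (m : Fin M) :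
    (N.Λof β m * N.B (N.Vof β p) (N.Qof β p) m).trace = 0 := by
  obtain ⟨⟨n, hn⟩, rfl⟩ := Fin.rev_surjective m
  rw [Λof_eq_outer hC hβ, trace_outer_mul, B_Vof_Qof hC hβ hp, smul_mulVec, ← mulVec_mulVec,
    elimMat_mulVec_lam (lam_diag_ne_zero hC hβ _)]
  simp

/-! ### The primal fixed point map -/

theorem qform_Vof (x : Fin M → ℂ) (β p : Fin K → ℝ) (k : Fin K) :
    qform x (N.Vof β p k) = p k * qform x (N.Vhat β k) := qform_smul _ _ _

theorem norm_inv_mulVec_ne_zero (hC : ∀ m, 0 < N.C m) (hh : ∀ k, N.h k ≠ 0) (hβ : 0 ≤ β)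
    (k : Fin K) : ‖WithLp.toLp 2 ((N.Cmat β (N.Λof β) k)⁻¹ *ᵥ N.h k)‖ ≠ 0 := by
  rw [norm_ne_zero_iff]
  exact fun h => inv_mulVec_ne_zero hC hh hβ k (congrArg WithLp.ofLp h)

theorem qform_Vhat_pos (hC : ∀ m, 0 < N.C m) (hh : ∀ k, N.h k ≠ 0) (hβ : 0 ≤ β) (k : Fin K) :
    0 < qform (N.h k) (N.Vhat β k) := by
  have hP := posDef_Cmat hC hβ k
  have h1 := norm_inv_mulVec_ne_zero hC hh hβ k
  have h2 := (qform_inv_pos hP (hh k)).ne'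
  rw [Vhat, qform_outer, direction, dotProduct_smul, qform_inv_ofReal hP]
  have : ((‖WithLp.toLp 2 ((N.Cmat β (N.Λof β) k)⁻¹ *ᵥ N.h k)‖⁻¹ : ℝ) : ℂ) •
      ((qform (N.h k) (N.Cmat β (N.Λof β) k)⁻¹ : ℝ) : ℂ) ≠ 0 := by
    rw [smul_eq_mul]
    exact_mod_cast mul_ne_zero (inv_ne_zero h1) h2
  exact pow_pos (norm_pos_iff.2 this) 2

theorem trace_Vhat (hC : ∀ m, 0 < N.C m) (hh : ∀ k, N.h k ≠ 0) (hβ : 0 ≤ β) (k : Fin K) :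
    (N.Vhat β k).trace = 1 := by
  have h1 := norm_inv_mulVec_ne_zero hC hh hβ k
  have h2 : ‖WithLp.toLp 2 ((N.Cmat β (N.Λof β) k)⁻¹ *ᵥ N.h k)‖ ^ 2 =
      ∑ i, ‖((N.Cmat β (N.Λof β) k)⁻¹ *ᵥ N.h k) i‖ ^ 2 := EuclideanSpace.norm_sq_eq _
  rw [Vhat, outer, trace_vecMulVec, dotProduct_comm, star_dotProduct_self]
  have : ∑ i, ‖N.direction β k i‖ ^ 2 = 1 := by
    simp only [direction, Pi.smul_apply, norm_smul, mul_pow, ← Finset.mul_sum]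
    rw [← h2, ← mul_pow, Complex.norm_real, norm_inv, norm_norm, inv_mul_cancel₀ h1, one_pow]
  rw [this, Complex.ofReal_one]

theorem trace_Vof (hC : ∀ m, 0 < N.C m) (hh : ∀ k, N.h k ≠ 0) (hβ : 0 ≤ β) (p : Fin K → ℝ)
    (k : Fin K) : (N.Vof β p k).trace = p k := by
  rw [Vof, trace_smul, trace_Vhat hC hh hβ, smul_eq_mul, mul_one]

theorem qform_Qof_mono (hC : ∀ m, 0 < N.C m) (hβ : 0 ≤ β) {p p' : Fin K → ℝ} (hpp' : p ≤ p')
    (x : Fin M → ℂ) : qform x (N.Qof β p) ≤ qform x (N.Qof β p') := by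
  have h := Qof_linear (N := N) (β := β) 1 (p' - p) p
  rw [one_smul, sub_add_cancel, Complex.ofReal_one, one_smul] at h
  rw [h, qform_add]
  have := qform_nonneg (posSemidef_Qof hC hβ (p := p' - p) (sub_nonneg.2 hpp')) x
  linarith

theorem Qof_smul (c : ℝ) (p : Fin K → ℝ) : N.Qof β (c • p) = (c : ℂ) • N.Qof β p := by
  have h0 : N.Qof β 0 = 0 := by
    have h := Qof_linear (N := N) (β := β) 1 0 0
    simp only [smul_zero, add_zero, Complex.ofReal_one, one_smul] at h
    exact left_eq_add.1 h
  have h := Qof_linear (N := N) (β := β) c p 0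
  rwa [add_zero, h0, add_zero] at h

/-- The primal fixed point map is affine with nonnegative coefficients and a positive constant
term, hence a standard interference function. -/
theorem isStandardInterference_primalMap (hσ : ∀ k, 0 < N.σ k) (hC : ∀ m, 0 < N.C m)
    (hγ : ∀ k, 0 < N.γ k) (hh : ∀ k, N.h k ≠ 0) (hβ : 0 ≤ β) :
    IsStandardInterference (N.primalMap β) where
  pos p hp k := by
    refine div_pos (mul_pos (hγ k) ?_) (qform_Vhat_pos hC hh hβ k)
    have h1 : 0 ≤ ∑ j ∈ Finset.univ.erase k, p j * qform (N.h k) (N.Vhat β j) :=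
      Finset.sum_nonneg fun j _ => mul_nonneg (hp j) (qform_nonneg (posSemidef_outer _) _)
    have h2 := qform_nonneg (posSemidef_Qof hC hβ hp) (N.h k)
    have h3 := pow_pos (hσ k) 2
    linarith
  mono p p' hp hpp' k := by
    refine div_le_div_of_nonneg_right (mul_le_mul_of_nonneg_left ?_ (hγ k).le)
      (qform_Vhat_pos hC hh hβ k).le
    refine add_le_add (add_le_add (Finset.sum_le_sum fun j _ => ?_)
      (qform_Qof_mono hC hβ hpp' _)) le_rfl
    exact mul_le_mul_of_nonneg_right (hpp' j) (qform_nonneg (posSemidef_outer _) _)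
  scale p hp α hα k := by
    rw [primalMap, primalMap, ← mul_div_assoc, mul_left_comm]
    refine div_lt_div_of_pos_right (mul_lt_mul_of_pos_left ?_ (hγ k)) (qform_Vhat_pos hC hh hβ k)
    rw [Qof_smul, qform_smul, mul_add, mul_add, Finset.mul_sum]
    have h3 := pow_pos (hσ k) 2
    have h4 : N.σ k ^ 2 < α * N.σ k ^ 2 := by nlinarith
    refine add_lt_add_of_le_of_lt (add_le_add (le_of_eq ?_) le_rfl) h4
    exact Finset.sum_congr rfl fun j _ => by simp [mul_assoc]

/-- The `k`-th SINR constraint measures the distance of `p_k` from its image under the primal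
map. -/
theorem a_Vof_Qof (hC : ∀ m, 0 < N.C m) (hγ : ∀ k, 0 < N.γ k) (hh : ∀ k, N.h k ≠ 0)
    (hβ : 0 ≤ β) (p : Fin K → ℝ) (k : Fin K) :
    N.a (N.Vof β p) (N.Qof β p) k =
      qform (N.h k) (N.Vhat β k) / N.γ k * (p k - N.primalMap β p k) := by
  have h1 := (qform_Vhat_pos hC hh hβ k).ne'
  have h2 := (hγ k).ne'
  simp only [a, qform_Vof, primalMap]
  field_simp
  ring

end Primal

/-! ### Lagrangian duality -/

section Duality

variable {N}

theorem trace_mul_tailBlock (m : Fin M) (A B : Matrix (Fin M) (Fin M) ℂ) :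
    (A * tailBlock m B).trace = (B * tailBlock m A).trace := by
  rw [trace_mul_comm B]
  simp only [Matrix.trace, Matrix.diag_apply, Matrix.mul_apply, tailBlock, of_apply]
  refine Finset.sum_congr rfl fun i _ => Finset.sum_congr rfl fun j _ => ?_
  simp only [and_comm, mul_ite, ite_mul, mul_zero, zero_mul]

theorem trace_mul_E (m : Fin M) (A : Matrix (Fin M) (Fin M) ℂ) : (A * E m).trace = A m m := by
  rw [trace_mul_comm, E, trace_single_mul]; simp

theorem trace_mul_outer_re (x : Fin M → ℂ) (A : Matrix (Fin M) (Fin M) ℂ) :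
    (A * outer x).trace.re = qform x A := by
  rw [trace_mul_comm, trace_outer_mul, qform]

theorem trace_mul_smul_re (c : ℝ) (A B : Matrix (Fin M) (Fin M) ℂ) :
    (A * ((c : ℂ) • B)).trace.re = c * (A * B).trace.re := by
  rw [Matrix.mul_smul, trace_smul, smul_eq_mul, Complex.re_ofReal_mul]

theorem trace_mul_sum_re {ι : Type*} (s : Finset ι) (A : Matrix (Fin M) (Fin M) ℂ)
    (B : ι → Matrix (Fin M) (Fin M) ℂ) :
    (A * ∑ i ∈ s, B i).trace.re = ∑ i ∈ s, (A * B i).trace.re := by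
  rw [Finset.mul_sum, trace_sum, Complex.re_sum]

theorem trace_mul_smul_E_re (z : ℂ) (m : Fin M) (A : Matrix (Fin M) (Fin M) ℂ) :
    (A * (z • E m)).trace.re = (z * A m m).re := by
  rw [Matrix.mul_smul, trace_smul, trace_mul_E, smul_eq_mul]

/-- The Lagrangian of the semidefinite relaxation, sorted by constraints on the left and by
primal variables on the right. -/
theorem lagrangian_eq (V : Fin K → Matrix (Fin M) (Fin M) ℂ) (Q : Matrix (Fin M) (Fin M) ℂ)
    (β : Fin K → ℝ) (Λ : Fin M → Matrix (Fin M) (Fin M) ℂ) :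
    ∑ k, (V k).trace.re + Q.trace.re - ∑ k, β k * N.a V Q k -
        ∑ m, (Λ m * N.B V Q m).trace.re =
      ∑ k, (V k * N.slackMat β Λ k).trace.re + (Q * N.D β Λ).trace.re +
        ∑ k, β k * N.σ k ^ 2 := by
  have hB : ∀ m, (Λ m * N.B V Q m).trace.re = N.η m * (Q * tailBlock m (Λ m)).trace.re -
      (∑ k, (Λ m m m * V k m m).re + (Λ m m m * Q m m).re) := by
    intro m
    rw [B, Matrix.mul_sub, trace_sub, Complex.sub_re, trace_mul_smul_re, trace_mul_smul_E_re,
      trace_mul_tailBlock, mul_comm (_ + _) (Λ m m m), mul_add, Finset.mul_sum, Complex.add_re,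
      Complex.re_sum]
  have hS : ∀ k, (V k * N.slackMat β Λ k).trace.re = (V k).trace.re +
      ∑ j, β j * qform (N.h j) (V k) - β k * qform (N.h k) (V k) +
      ∑ m, (Λ m m m * V k m m).re - β k / N.γ k * qform (N.h k) (V k) := by
    intro k
    rw [slackMat, Cmat, Matrix.mul_sub, Matrix.mul_add, Matrix.mul_add, Matrix.mul_one, trace_sub,
      trace_add, trace_add, Complex.sub_re, Complex.add_re, Complex.add_re, trace_mul_sum_re,
      trace_mul_sum_re]
    simp only [trace_mul_smul_re, trace_mul_smul_E_re, trace_mul_outer_re]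
    rw [Finset.sum_erase_eq_sub (Finset.mem_univ k)]
    ring
  have hD : (Q * N.D β Λ).trace.re = Q.trace.re + ∑ k, β k * qform (N.h k) Q +
      ∑ m, (Λ m m m * Q m m).re - ∑ m, N.η m * (Q * tailBlock m (Λ m)).trace.re := by
    rw [D, Γ, Matrix.mul_sub, Matrix.mul_add, Matrix.mul_add, Matrix.mul_one, trace_sub,
      trace_add, trace_add, Complex.sub_re, Complex.add_re, Complex.add_re, trace_mul_sum_re,
      trace_mul_sum_re, trace_mul_sum_re]
    simp only [trace_mul_smul_re, trace_mul_smul_E_re, trace_mul_outer_re]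
  have ha : ∀ k, β k * N.a V Q k = β k / N.γ k * qform (N.h k) (V k) -
      ∑ j, β k * qform (N.h k) (V j) + β k * qform (N.h k) (V k) - β k * qform (N.h k) Q -
      β k * N.σ k ^ 2 := by
    intro k
    rw [a, Finset.sum_erase_eq_sub (Finset.mem_univ k), ← Finset.mul_sum]
    ring
  simp only [hB, hS, hD, ha, Finset.sum_add_distrib, Finset.sum_sub_distrib]
  rw [Finset.sum_comm (f := fun k j => β j * qform (N.h j) (V k)),
    Finset.sum_comm (f := fun m k => (Λ m m m * V k m m).re)]
  ring

/-- Weak duality. -/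
theorem sum_mul_sq_le {V : Fin K → Matrix (Fin M) (Fin M) ℂ} {Q : Matrix (Fin M) (Fin M) ℂ}
    {β : Fin K → ℝ} {Λ : Fin M → Matrix (Fin M) (Fin M) ℂ} (hV : ∀ k, (V k).PosSemidef)
    (ha : ∀ k, 0 ≤ N.a V Q k) (hβ : 0 ≤ β) (hS : ∀ k, (N.slackMat β Λ k).PosSemidef)
    (hD : N.D β Λ = 0) (hB : ∀ m, 0 ≤ (Λ m * N.B V Q m).trace.re) :
    ∑ k, β k * N.σ k ^ 2 ≤ ∑ k, (V k).trace.re + Q.trace.re := by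
  have h := lagrangian_eq (N := N) V Q β Λ
  rw [hD, Matrix.mul_zero, trace_zero, Complex.zero_re] at h
  have h1 : 0 ≤ ∑ k, β k * N.a V Q k := Finset.sum_nonneg fun k _ => mul_nonneg (hβ k) (ha k)
  have h2 : 0 ≤ ∑ m, (Λ m * N.B V Q m).trace.re := Finset.sum_nonneg fun m _ => hB m
  have h3 : 0 ≤ ∑ k, (V k * N.slackMat β Λ k).trace.re :=
    Finset.sum_nonneg fun k _ => trace_mul_nonneg (hV k) (hS k)
  linarith

/-- A matrix that vanishes outside a diagonal block and is positive semidefinite on the block has a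
nonnegative form. -/
theorem qform_nonneg_of_submatrix {m : Fin M} {A : Matrix (Fin M) (Fin M) ℂ}
    (hA : ∀ i j, ¬(m ≤ i ∧ m ≤ j) → A i j = 0)
    (hP : (A.submatrix (Subtype.val : {i : Fin M // m ≤ i} → Fin M)
      (Subtype.val : {i : Fin M // m ≤ i} → Fin M)).PosSemidef) (x : Fin M → ℂ) :
    0 ≤ qform x A := by
  have h := hP.re_dotProduct_nonneg fun i => x i
  have hsum : ∀ f : Fin M → ℂ, (∀ i, ¬m ≤ i → f i = 0) →
      ∑ i, f i = ∑ i : {i : Fin M // m ≤ i}, f i := fun f hf => by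
    rw [← Fintype.sum_subtype_add_sum_subtype (fun i => m ≤ i) f,
      Finset.sum_eq_zero (s := (Finset.univ : Finset {i // ¬m ≤ i})) fun i _ => hf i i.2, add_zero]
  have key : star x ⬝ᵥ (A *ᵥ x) = (star fun i : {i : Fin M // m ≤ i} => x i) ⬝ᵥ
      (A.submatrix Subtype.val Subtype.val *ᵥ fun i : {i : Fin M // m ≤ i} => x i) := by
    simp only [dotProduct, mulVec, submatrix_apply, Pi.star_apply]
    rw [hsum]
    · refine Finset.sum_congr rfl fun i _ => ?_
      rw [hsum]
      intro j hj
      rw [hA i j fun h => hj h.2, zero_mul]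
    · intro i hi
      rw [Finset.sum_eq_zero, mul_zero]
      intro j _
      rw [hA i j fun h => hi h.1, zero_mul]
  rw [qform, key]
  exact h

theorem h_ne_zero (hσ : ∀ k, 0 < N.σ k) (hN : N.StrictlyFeasible) (k : Fin K) : N.h k ≠ 0 := by
  intro h0
  obtain ⟨V, Q, -, -, ha, -⟩ := hN
  have h1 := ha k
  have h2 := pow_pos (hσ k) 2
  simp [a, h0, qform] at h1
  linarith

theorem exists_bound_dualMap (hσ : ∀ k, 0 < N.σ k) (hγ : ∀ k, 0 < N.γ k) (hC : ∀ m, 0 < N.C m)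
    (hN : N.StrictlyFeasible) :
    ∃ R : ℝ, ∀ β : Fin K → ℝ, 0 ≤ β → β ≤ N.dualMap β → ∀ k, β k ≤ R := by
  have hh := h_ne_zero hσ hN
  obtain ⟨V, Q, hV, -, ha, hB⟩ := hN
  set P := ∑ k, (V k).trace.re + Q.trace.re
  obtain ⟨R, hR⟩ := (Set.finite_range fun k => P / N.σ k ^ 2).bddAbove
  refine ⟨R, fun β hβ hle k => (?_ : β k ≤ P / N.σ k ^ 2).trans (hR ⟨k, rfl⟩)⟩
  rw [le_div_iff₀ (pow_pos (hσ k) 2)]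
  refine (Finset.single_le_sum (f := fun k => β k * N.σ k ^ 2)
    (fun j _ => mul_nonneg (hβ j) (sq_nonneg _)) (Finset.mem_univ k)).trans ?_
  refine sum_mul_sq_le (Λ := N.Λof β) (fun k => (hV k).posSemidef) (fun k => (ha k).le) hβ
    (posSemidef_slackMat hC hγ hh hβ hle) (D_Λof_eq_zero hC hβ) fun m => ?_
  rw [Λof_eq_outer hC hβ, trace_outer_mul]
  refine qform_nonneg_of_submatrix (m := m) (fun i j hij => ?_) (hB m).posSemidef _
  have h1 : E m i j = 0 := by
    rw [E, single_apply, if_neg]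
    rintro ⟨rfl, rfl⟩
    exact hij ⟨le_rfl, le_rfl⟩
  rw [B, Matrix.sub_apply, Matrix.smul_apply, Matrix.smul_apply, h1, tailBlock, of_apply,
    if_neg hij, smul_zero, smul_zero, sub_zero]

variable {β p : Fin K → ℝ}

theorem trace_Vof_mul_slackMat (hC : ∀ m, 0 < N.C m) (hγ : ∀ k, 0 < N.γ k)
    (hh : ∀ k, N.h k ≠ 0) (hβ : 0 ≤ β) (hfix : N.dualMap β = β) (p : Fin K → ℝ) (k : Fin K) :
    (N.Vof β p k * N.slackMat β (N.Λof β) k).trace = 0 := by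
  rw [Vof, smul_mul_assoc, trace_smul, Vhat, trace_outer_mul, direction, mulVec_smul,
    slackMat_mulVec hC hγ hh hβ hfix]
  simp

/-- The total power of a recovered point in terms of the SINR constraints: all other terms of the
Lagrangian vanish. -/
theorem sum_add_trace_Qof (hC : ∀ m, 0 < N.C m) (hγ : ∀ k, 0 < N.γ k)
    (hh : ∀ k, N.h k ≠ 0) (hβ : 0 ≤ β) (hfix : N.dualMap β = β) (hp : 0 ≤ p) :
    ∑ k, (N.Vof β p k).trace.re + (N.Qof β p).trace.re =
      ∑ k, β k * N.a (N.Vof β p) (N.Qof β p) k + ∑ k, β k * N.σ k ^ 2 := by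
  have h := lagrangian_eq (N := N) (N.Vof β p) (N.Qof β p) β (N.Λof β)
  simp only [D_Λof_eq_zero hC hβ, trace_Vof_mul_slackMat hC hγ hh hβ hfix,
    trace_Λof_mul_B hC hβ hp, Matrix.mul_zero, trace_zero, Complex.zero_re,
    Finset.sum_const_zero, sub_zero, add_zero, zero_add] at h
  linarith

theorem le_of_le_primalMap (hC : ∀ m, 0 < N.C m) (hγ : ∀ k, 0 < N.γ k)
    (hh : ∀ k, N.h k ≠ 0) (hβ : 0 ≤ β) (hfix : N.dualMap β = β) (hp : 0 ≤ p)
    (hle : p ≤ N.primalMap β p) (k : Fin K) : p k ≤ ∑ k, β k * N.σ k ^ 2 := by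
  have h := sum_add_trace_Qof hC hγ hh hβ hfix hp
  have h1 : ∑ k, β k * N.a (N.Vof β p) (N.Qof β p) k ≤ 0 :=
    Finset.sum_nonpos fun k _ => by
      rw [a_Vof_Qof hC hγ hh hβ]
      exact mul_nonpos_of_nonneg_of_nonpos (hβ k) (mul_nonpos_of_nonneg_of_nonpos
        (div_nonneg (qform_Vhat_pos hC hh hβ k).le (hγ k).le) (sub_nonpos.2 (hle k)))
  have h2 : 0 ≤ (N.Qof β p).trace.re :=
    (Complex.le_def.1 (posSemidef_Qof hC hβ hp).trace_nonneg).1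
  simp only [trace_Vof hC hh hβ, Complex.ofReal_re] at h
  have h3 := Finset.single_le_sum (f := p) (fun j _ => hp j) (Finset.mem_univ k)
  linarith

end Duality

/-! ### Optimality -/

section Optimality

variable {N} {β p : Fin K → ℝ}

theorem enhancedKKT (hC : ∀ m, 0 < N.C m) (hγ : ∀ k, 0 < N.γ k) (hh : ∀ k, N.h k ≠ 0)
    (hβ : 0 ≤ β) (hfix : N.dualMap β = β) (hp : ∀ k, 0 < p k) (hfixp : N.primalMap β p = p) :
    N.EnhancedKKT (N.Vof β p) (N.Qof β p) β (N.Λof β) := by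
  have hp0 : 0 ≤ p := fun k => (hp k).le
  refine
    { slack_V := trace_Vof_mul_slackMat hC hγ hh hβ hfix p
      slack_B := trace_Λof_mul_B hC hβ hp0
      dual_D := D_Λof_eq_zero hC hβ
      dual_rank := fun m => ?_
      dual_psd := fun m => ?_
      dual_support := fun m i j hij => ?_
      dual_nonneg := hβ
      dual_slack_rank := rank_slackMat hC hγ hh hβ hfix
      dual_slack_psd := posSemidef_slackMat hC hγ hh hβ hfix.ge
      primal_psd := fun k => ?_
      primal_rank := fun k => ?_
      primal_sinr := fun k => ?_
      primal_fronthaul := posSemidef_B hC hβ hp0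
      primal_cov := posSemidef_Qof hC hβ hp0 }
  · rw [Λof_eq_outer hC hβ]
    exact rank_vecMulVec_le _ _
  · rw [Λof_eq_outer hC hβ]
    exact posSemidef_outer _
  · simp [Λof, lambdaOf, hij]
  · exact (posSemidef_outer _).smul (by exact_mod_cast hp0 k)
  · refine le_antisymm ?_ (Nat.one_le_iff_ne_zero.2 fun h0 => ?_)
    · rw [Vof, Vhat, outer, ← smul_vecMulVec]
      exact rank_vecMulVec_le _ _
    · have h1 := trace_Vof hC hh hβ p k
      have h2 : N.Vof β p k = 0 := by
        rw [Matrix.rank, Submodule.finrank_eq_zero, LinearMap.range_eq_bot] at h0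
        exact (Matrix.toLin' (R := ℂ)).map_eq_zero_iff.1 h0
      rw [h2, trace_zero] at h1
      exact (hp k).ne (by exact_mod_cast h1)
  · rw [a_Vof_Qof hC hγ hh hβ, hfixp, sub_self, mul_zero]

theorem exists_outer_eq_Vof (hp : 0 ≤ p) :
    ∃ v : Fin K → Fin M → ℂ, ∀ k, N.Vof β p k = outer (v k) := by
  refine ⟨fun k => (Real.sqrt (p k) : ℂ) • N.direction β k, fun k => ?_⟩
  have hs : star (Real.sqrt (p k) : ℂ) = (Real.sqrt (p k) : ℂ) := Complex.conj_ofReal _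
  rw [Vof, Vhat, outer, outer, star_smul, hs, smul_vecMulVec, vecMulVec_smul, smul_smul,
    ← Complex.ofReal_mul, Real.mul_self_sqrt (hp k)]

theorem outer_diag (x : Fin M → ℂ) (m : Fin M) : outer x m m = ((‖x m‖ ^ 2 : ℝ) : ℂ) := by
  simp [outer, vecMulVec_apply, Complex.mul_conj']

/-- Problem (P) is the semidefinite relaxation restricted to rank-one matrices `V k`. -/
theorem isFeasible_iff (v : Fin K → Fin M → ℂ) (Q : Matrix (Fin M) (Fin M) ℂ) :
    N.IsFeasible v Q ↔ Q.PosSemidef ∧ (∀ k, 0 ≤ N.a (fun k => outer (v k)) Q k) ∧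
      ∀ m, (N.B (fun k => outer (v k)) Q m).PosSemidef := by
  have ha : ∀ k, N.a (fun k => outer (v k)) Q k = 1 / N.γ k * ‖star (N.h k) ⬝ᵥ v k‖ ^ 2 -
      (∑ j ∈ Finset.univ.erase k, ‖star (N.h k) ⬝ᵥ v j‖ ^ 2 + qform (N.h k) Q + N.σ k ^ 2) := by
    intro k
    simp only [a, qform_outer]
    ring
  have hB : ∀ m, N.B (fun k => outer (v k)) Q m = (N.η m : ℂ) • tailBlock m Q -
      (((∑ k, ‖v k m‖ ^ 2 : ℝ) : ℂ) + Q m m) • E m := by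
    intro m
    simp only [B, outer_diag]
    push_cast
    rfl
  simp only [ha, hB]
  exact ⟨fun h => ⟨h.cov, h.sinr, h.fronthaul⟩, fun h => ⟨h.1, h.2.1, h.2.2⟩⟩

theorem power_eq (v : Fin K → Fin M → ℂ) (Q : Matrix (Fin M) (Fin M) ℂ) :
    power v Q = ∑ k, (outer (v k)).trace.re + Q.trace.re := by
  rw [power]
  congr 1
  refine Finset.sum_congr rfl fun k _ => ?_
  simp only [Matrix.trace, Matrix.diag_apply, outer_diag, Complex.re_sum, Complex.ofReal_re]

/-- A rank-one point satisfying the KKT conditions of the relaxation is optimal for (P). -/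
theorem EnhancedKKT.isGlobalOptimum {v : Fin K → Fin M → ℂ} {Q : Matrix (Fin M) (Fin M) ℂ}
    {Λ : Fin M → Matrix (Fin M) (Fin M) ℂ}
    (h : N.EnhancedKKT (fun k => outer (v k)) Q β Λ) : N.IsGlobalOptimum v Q := by
  refine ⟨(isFeasible_iff v Q).2 ⟨h.primal_cov, fun k => (h.primal_sinr k).ge,
    h.primal_fronthaul⟩, fun v' Q' hf => ?_⟩
  obtain ⟨-, ha, hB⟩ := (isFeasible_iff v' Q').1 hf
  have h1 := lagrangian_eq (N := N) (fun k => outer (v k)) Q β Λ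
  simp only [h.slack_V, h.slack_B, h.dual_D, h.primal_sinr, trace_zero,
    Complex.zero_re, mul_zero, Finset.sum_const_zero, sub_zero, zero_add] at h1
  rw [power_eq, power_eq, h1]
  exact sum_mul_sq_le (fun k => posSemidef_outer _) ha h.dual_nonneg h.dual_slack_psd h.dual_D
    fun m => trace_mul_nonneg (h.dual_psd m) (hB m)

end Optimality

end RelayNetwork

theorem theorem3 {M K : ℕ} (N : RelayNetwork M K)
    (hσ : ∀ k, 0 < N.σ k) (hγ : ∀ k, 0 < N.γ k) (hC : ∀ m, 0 < N.C m)
    (hN : N.StrictlyFeasible)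
    (β₀ p₀ : Fin K → ℝ) (hβ₀ : ∀ k, 0 ≤ β₀ k) (hp₀ : ∀ k, 0 ≤ p₀ k) :
    ∃ β p : Fin K → ℝ,
      Tendsto (fun i : ℕ => N.dualMap^[i] β₀) atTop (𝓝 β) ∧
      N.dualMap β = β ∧
      Tendsto (fun i : ℕ => (N.primalMap β)^[i] p₀) atTop (𝓝 p) ∧
      N.primalMap β p = p ∧
      N.EnhancedKKT (N.Vof β p) (N.Qof β p) β (N.Λof β) ∧
      (∃ v : Fin K → Fin M → ℂ, ∀ k, N.Vof β p k = RelayNetwork.outer (v k)) ∧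
      ∀ v : Fin K → Fin M → ℂ, (∀ k, N.Vof β p k = RelayNetwork.outer (v k)) →
        N.IsGlobalOptimum v (N.Qof β p) := by
  have hh := RelayNetwork.h_ne_zero hσ hN
  obtain ⟨β, hβfix, hβpos, hβlim⟩ :=
    (RelayNetwork.isStandardInterference_dualMap hC hγ hh).exists_fixed
      (RelayNetwork.exists_bound_dualMap hσ hγ hC hN)
  have hβ : 0 ≤ β := fun k => (hβpos k).le
  obtain ⟨p, hpfix, hppos, hplim⟩ :=
    (RelayNetwork.isStandardInterference_primalMap hσ hC hγ hh hβ).exists_fixed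
      ⟨_, fun _ hp hle => RelayNetwork.le_of_le_primalMap hC hγ hh hβ hβfix hp hle⟩
  have hKKT := RelayNetwork.enhancedKKT hC hγ hh hβ hβfix hppos hpfix
  refine ⟨β, p, hβlim β₀ hβ₀, hβfix, hplim p₀ hp₀, hpfix, hKKT,
    RelayNetwork.exists_outer_eq_Vof fun k => (hppos k).le, fun v hv => ?_⟩
  rw [funext hv] at hKKT
  exact hKKT.isGlobalOptimum
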